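/- Fix an alphabet $\Sigma$ of size $\sigma\ge 2$. A *one-stream machine* with $m$ bits of memory is a deterministic machine whose memory takes values in $\{0,1\}^m$ and which works on one read/write stream: a tape of cells that initially holds the input $s\in\Sigma^*$ and is otherwise blank. In each step, depending only on its memory and on the cell under its head, it either halts or changes its memory, overwrites that cell (with a symbol of $\Sigma$, a blank, or one of finitely many auxiliary symbols), appends finitely many bits to a write-only output, and moves its head by at most one cell. It *uses $p$ passes* on an input if it halts after at most $p$ rightward and at most $p$ leftward sweeps of the head, i.e. after fewer than $2p$ reversals. It is *lossless* for length $n$ (with $p$ passes) if it uses $p$ passes on every $s\in\Sigma^n$ and distinct $s\in\Sigma^n$ give distinct outputs. Machines may be chosen separately for each $n$. A context-free grammar over $\Sigma$ has nonterminals numbered by natural numbers. It is written in bits as the sequence of its start symbol and its productions (left-hand side, right-hand side, end mark), every symbol being written with the same number of bits, namely the number needed for the largest symbol code, preceded by this number in unary; its size $|G|$ is the length of this bit string. Let $|\mathsf{OPT}(s)|$ be the size of the smallest grammar that generates $s$ and only $s$. For a nonempty string $t$, let $t^{(n)}$ be the string of length $n$ consisting of $\lfloor n/|t|\rfloor$ copies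 of $t$ followed by a proper prefix of $t$. Let $K$ denote plain Kolmogorov complexity, and $\log=\log_2$. **Theorem.** Let $m,p:\mathbb N\to\mathbb N_{\ge1}$ with $m(n)p(n)=\log^{O(1)}n$, and let $\ell(n)=\lceil m(n)p(n)\log n\rceil$. 1. For every $C\in\mathbb N$ and all sufficiently large $n$: for every one-stream machine with $m(n)$ bits of memory that, on each $s\in\Sigma^n$, uses $p(n)$ passes and outputs (in bits) a grammar $\mathsf{APPROX}(s)$ that generates $s$ and only $s$, there is an $s\in\Sigma^n$ with $|\mathsf{APPROX}(s)|>|\mathsf{OPT}(s)|^C$. In particular, one-stream algorithms cannot achieve $|\mathsf{APPROX}|\le|\mathsf{OPT}|^{O(1)}$. 2. There is a $k$ such that $|\mathsf{OPT}(t^{(n)})|\le\log^k n$ for all sufficiently large $n$ and all $t\in\Sigma^{\ell(n)}$. 3. For every $\varepsilon>0$ there is a $c>0$ such that, for all sufficiently large $n$ and every one-stream machine with $m(n)$ bits of memory that is lossless for length $n$ with $p(n)$ passes, all but at most $2^{\varepsilon\ell(n)}$ of the strings $t\in\Sigma^{\ell(n)}$ are such that the machine outputs at least $cn$ bits on $t^{(n)}$.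 4. Let $A_0,A_1,\dots$ be one-stream algorithms, each a family of machines, one for each $n$, with $m(n)$ bits of memory and lossless for length $n$ with $p(n)$ passes. Then there are strings $t_n\in\Sigma^{\ell(n)}$ with $K(t_n)\ge\ell(n)\log\sigma-2$ for every $n$, and a $c>0$, such that each $A_i$ outputs at least $cn$ bits on $t_n^{(n)}$ for all sufficiently large $n$. -/

import Mathlib

open Filter Asymptotics

/-! ### One-stream read/write machines -/

/-- A possible movement of the head on the stream. -/
inductive StreamMove
  | left
  | stay
  | right

/-- A cell of the stream: blank (`none`), an input character, or one of the auxiliary symbols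
that the machine may write. -/
abbrev StreamCell (σ : ℕ) (Aux : Type) : Type := Option (Fin σ ⊕ Aux)

/-- A deterministic machine with one read/write stream and `m` bits of memory, for input strings
over the alphabet `Fin σ`. In one step it looks at its memory and at the cell under its head; it
either halts (`none`) or changes its memory, overwrites the cell, appends finitely many bits to
its output and moves its head. The machine never sees the position of its head. -/
structure OneStreamMachine (σ m : ℕ) where
  /-- the auxiliary stream symbols -/
  Aux : Type
  /-- there are finitely many of them -/
  finiteAux : Finite Aux
  /-- the initial memory contents -/
  init : Fin m → Bool
  /-- new memory, symbol written, bits output, head movement; `none` means halt -/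
  trans : (Fin m → Bool) → StreamCell σ Aux →
    Option ((Fin m → Bool) × StreamCell σ Aux × List Bool × StreamMove)

namespace OneStreamMachine

variable {σ m : ℕ}

/-- A complete snapshot of a computation. The last two fields only serve to count the
reversals of the head; the machine has no access to them, nor to `output`. -/
structure Snapshot (M : OneStreamMachine σ m) where
  memory : Fin m → Bool
  stream : ℤ → StreamCell σ M.Aux
  head : ℤ
  output : List Bool
  /-- whether the head's last movement was to the right -/
  rightward : Bool
  /-- how often the head has changed its direction of movement -/
  reversals : ℕ

/-- At the start cells `0, …, |s| - 1` hold the input `s`, the others are blank, and the head is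
on cell `0`, in its first (rightward) sweep. -/
def start (M : OneStreamMachine σ m) (s : List (Fin σ)) : M.Snapshot where
  memory := M.init
  stream := fun z => if 0 ≤ z then (s[z.toNat]?).map Sum.inl else none
  head := 0
  output := []
  rightward := true
  reversals := 0

/-- One step of the computation; `none` when the machine has halted. -/
def step (M : OneStreamMachine σ m) (c : M.Snapshot) : Option M.Snapshot :=
  (M.trans c.memory (c.stream c.head)).map fun (memory', symbol, bits, move) =>
    { memory := memory'
      stream := Function.update c.stream c.head symbol
      head := match move with
        | .left => c.head - 1
        | .stay => c.head
        | .right => c.head + 1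
      output := c.output ++ bits
      rightward := match move with
        | .left => false
        | .stay => c.rightward
        | .right => true
      reversals := match move, c.rightward with
        | .left, true => c.reversals + 1
        | .right, false => c.reversals + 1
        | _, _ => c.reversals }

/-- On input `s` the machine halts after at most `p` passes and its complete output is `w`. Here
`p` passes mean at most `p` rightward sweeps of the head and at most `p` leftward ones (during
which the machine need not just rewind, it may also work), i.e., fewer than `2 * p` reversals. -/
def Outputs (M : OneStreamMachine σ m) (p : ℕ) (s : List (Fin σ)) (w : List Bool) : Prop :=
  ∃ c : M.Snapshot, StateTransition.Reaches M.step (M.start s) c ∧ M.step c = none ∧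
    c.output = w ∧ c.reversals < 2 * p

/-- The machine is a lossless compressor, with `p` passes, for the strings of length `n`. -/
def IsLossless (M : OneStreamMachine σ m) (p n : ℕ) : Prop :=
  (∀ s : List (Fin σ), s.length = n → ∃ w, M.Outputs p s w) ∧
  ∀ (s s' : List (Fin σ)) (w : List Bool), s.length = n → s'.length = n →
    M.Outputs p s w → M.Outputs p s' w → s = s'

end OneStreamMachine

/-! ### Context-free grammars and their sizes in bits -/

/-- A context-free grammar over the terminals `Fin σ`, whose nonterminals are numbered by natural
numbers, written down as its start symbol and the list of its productions. -/
structure WrittenGrammar (σ : ℕ) where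
  start : ℕ
  rules : List (ContextFreeRule (Fin σ) ℕ)

namespace WrittenGrammar

variable {σ : ℕ}

/-- The grammar as an abstract context-free grammar. -/
def toCFG (G : WrittenGrammar σ) : ContextFreeGrammar (Fin σ) where
  NT := ℕ
  initial := G.start
  rules := G.rules.toFinset

/-- The grammar generates `s` and only `s`. -/
def GeneratesOnly (G : WrittenGrammar σ) (s : List (Fin σ)) : Prop :=
  G.toCFG.language = {s}

/-- The number of a symbol (`0` is reserved as the end-of-production mark). -/
def symbolCode : Symbol (Fin σ) ℕ → ℕ
  | .terminal a => a + 1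
  | .nonterminal i => σ + 1 + i

/-- The grammar as a sequence of numbers: the start symbol, and then, for each production, its
left-hand side, its right-hand side and an end mark. -/
def codes (G : WrittenGrammar σ) : List ℕ :=
  symbolCode (σ := σ) (.nonterminal G.start) :: G.rules.flatMap fun r =>
    symbolCode (σ := σ) (.nonterminal r.input) :: (r.output.map symbolCode ++ [0])

/-- The number of bits needed for the largest of the numbers. -/
def width (G : WrittenGrammar σ) : ℕ := (G.codes.foldr max 0).size

/-- The grammar as a bit string: the width in unary, and then each of the numbers in binary
(least significant bit first) with exactly that many bits. -/
def toBits (G : WrittenGrammar σ) : List Bool :=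
  List.replicate G.width true ++ false ::
    G.codes.flatMap fun x => (List.range G.width).map x.testBit

end WrittenGrammar

/-- The size in bits of the smallest grammar that generates `s` and only `s`. -/
noncomputable def smallestGrammarSize {σ : ℕ} (s : List (Fin σ)) : ℕ :=
  sInf {k | ∃ G : WrittenGrammar σ, G.GeneratesOnly s ∧ G.toBits.length = k}

/-! ### Periodic strings -/

/-- The string of length `n` (for nonempty `t`) that consists of `⌊n / |t|⌋` copies of `t`,
followed by a proper prefix of `t`. -/
def periodicString {σ : ℕ} (t : List (Fin σ)) (n : ℕ) : List (Fin σ) :=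
  ((List.replicate n t).flatten).take n

/-! ### Kolmogorov complexity -/

/-- The bit string `w` is a program that prints `x`, for the universal machine that reads
`1ⁱ 0 y` as: run the `i`-th partial recursive function on the input `y`. -/
def IsProgramFor {σ : ℕ} (w : List Bool) (x : List (Fin σ)) : Prop :=
  ∃ (i : ℕ) (y : List Bool), w = List.replicate i true ++ false :: y ∧
    Encodable.encode x ∈ (Denumerable.ofNat Nat.Partrec.Code i).eval (Encodable.encode y)

/-- The (plain) Kolmogorov complexity of `x`: the length of the shortest program for it. -/
noncomputable def kolmogorovComplexity {σ : ℕ} (x : List (Fin σ)) : ℕ :=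
  sInf {k | ∃ w : List Bool, IsProgramFor w x ∧ w.length = k}

/-- Every string has a program, so the minimum above is attained. -/
theorem exists_isProgramFor {σ : ℕ} (x : List (Fin σ)) : ∃ w : List Bool, IsProgramFor w x := by
  refine ⟨_, Encodable.encode (Nat.Partrec.Code.const (Encodable.encode x)), [], rfl, ?_⟩
  rw [Denumerable.ofNat_encode, Nat.Partrec.Code.eval_const]
  exact Part.mem_some _

/-- Every string has a grammar, so the minimum in `smallestGrammarSize` is attained. -/
theorem exists_generatesOnly {σ : ℕ} (s : List (Fin σ)) :
    ∃ G : WrittenGrammar σ, G.GeneratesOnly s := by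
  let r₀ : ContextFreeRule (Fin σ) ℕ := ⟨0, s.map .terminal⟩
  let G : WrittenGrammar σ := ⟨0, [r₀]⟩
  have hG : ∀ u v : List (Symbol (Fin σ) ℕ), G.toCFG.Produces u v ↔ r₀.Rewrites u v := by
    intro u v
    constructor
    · rintro ⟨r, hr, hrw⟩
      have h1 : r = r₀ := by
        have h2 : ∀ r' : ContextFreeRule (Fin σ) ℕ, r' ∈ [r₀].toFinset → r' = r₀ :=
          fun r' h => List.mem_singleton.1 (List.mem_toFinset.1 h)
        exact h2 r hr
      exact h1 ▸ hrw
    · intro h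
      refine ⟨r₀, ?_, h⟩
      show r₀ ∈ ([r₀].toFinset : Finset (ContextFreeRule (Fin σ) ℕ))
      simp
  have key : ∀ u : List (Symbol (Fin σ) ℕ), G.toCFG.Derives [Symbol.nonterminal (0 : ℕ)] u →
      u = [Symbol.nonterminal 0] ∨ u = s.map .terminal := by
    intro u hu
    induction hu with
    | refl => exact Or.inl rfl
    | tail _ hstep ih =>
      obtain ⟨a, b, h1, h2⟩ := ((hG _ _).1 hstep).exists_parts
      rcases ih with h | h
      · have h3 := h.symm.trans h1
        rcases a with _ | ⟨_, a⟩
        · simp [r₀] at h3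
          subst h3
          exact Or.inr (by simpa [r₀] using h2)
        · simp at h3
      · have h3 : Symbol.nonterminal (0 : ℕ) ∈ s.map (Symbol.terminal (N := ℕ)) := by
          have h4 := h.symm.trans h1
          rw [h4]
          simp [r₀]
        simp at h3
  refine ⟨G, ?_⟩
  refine Set.ext fun w => ⟨fun hw => ?_, fun hw => ?_⟩
  · rcases key _ hw with h | h
    · have h1 : w.map (Symbol.terminal (N := ℕ)) = [Symbol.nonterminal 0] := h
      rcases w with _ | ⟨_, _⟩ <;> simp at h1
    · exact List.map_injective_iff.2 (fun _ _ h => by simpa using h) h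
  · obtain rfl : w = s := hw
    refine Relation.ReflTransGen.single ((hG _ _).2 ?_)
    have h := ContextFreeRule.Rewrites.head (r := r₀) []
    rw [List.append_nil] at h
    exact h

/-! Run a lossless machine on `periodicString t n`, which contains about `n / ℓ` blocks equal to
`t`. The transcript of one block records the bits output while the head is there and, at each border
crossing, the memory and the head position. This transcript determines `t`: if `t` and `t'` give the
same transcript in block `i`, then pasting `t'` into that block alone does not change the output
(`HaltingTrace.paste`), so losslessness forces `t = t'` (`IsLossless.eq_of_regionTranscript_eq`).

With `p` passes each border is crossed at most `2 * p` times, so a block in which at most `L` bits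
are output has a transcript of `2 * L + O(m * p)` bits, and few `t` share that property for a given
block. If the total output is small, at least half of the blocks output at most `L` bits; double
counting pairs of strings and blocks bounds the number of such `t` (`IsLossless.ncard_le`). Since `ℓ
≥ m * p * log n`, the crossings cost only `o(ℓ)` bits, and `L` of order `ε * ℓ` leaves at most `2 ^
(ε * ℓ)` exceptional `t`.

On the other hand, repeated doubling gives `periodicString t n` a grammar of polylogarithmic size
(`power_generatesOnly`). A machine that outputs grammars is lossless, because a grammar can be
decoded from its bits (`toBits_injective`); so on some periodic string it outputs `Ω(n)` bits, more
than any power of the optimum. For countably many algorithms, `t n` avoids the exceptional sets of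
the first `ℓ n` of them and the compressible strings, which together do not exhaust all strings of
length `ℓ n`. -/

/-! ### Cutting and pasting computations -/

/-- The displacement of the head. -/
def StreamMove.offset : StreamMove → ℤ
  | .left => -1
  | .stay => 0
  | .right => 1

/-- What an observer of a region of the stream records: a bit output while the head is in the
region, or the head crossing the border of the region, with the new memory and position. -/
inductive RegionEvent (m : ℕ)
  | bit (b : Bool)
  | hand (q : Fin m → Bool) (h : ℤ)

/-- A step of a computation: the old position of the head, the bits output, the new memory and
the new position of the head. -/
structure StepRecord (m : ℕ) where
  source : ℤ
  bits : List Bool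
  memory : Fin m → Bool
  target : ℤ

open Classical in
/-- The events in the region `J` during a step. -/
noncomputable def StepRecord.events {m : ℕ} (J : Set ℤ) (e : StepRecord m) :
    List (RegionEvent m) :=
  (if e.source ∈ J then e.bits.map .bit else []) ++
    if (e.source ∈ J ↔ e.target ∈ J) then [] else [.hand e.memory e.target]

/-- The transcript of a computation in the region `J`. -/
noncomputable def regionTranscript {m : ℕ} (J : Set ℤ) (tr : List (StepRecord m)) :
    List (RegionEvent m) :=
  tr.flatMap (StepRecord.events J)

/-- The transcripts `G` in the region that contains the head and `H` in the complementary region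
interleave to an output `W`. -/
inductive Interleave {m : ℕ} : List (RegionEvent m) → List (RegionEvent m) → List Bool → Prop
  | nil : Interleave [] [] []
  | bit {G H W} (b : Bool) : Interleave G H W → Interleave (.bit b :: G) H (b :: W)
  | hand {G H W} (q h) : Interleave H G W → Interleave (.hand q h :: G) (.hand q h :: H) W

namespace Interleave

variable {m : ℕ} {G H : List (RegionEvent m)} {W : List Bool}

theorem append_bits (h : Interleave G H W) (bits : List Bool) :
    Interleave (bits.map .bit ++ G) H (bits ++ W) := by
  induction bits with
  | nil => exact h
  | cons b bits ih => exact .bit b ih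

theorem of_append_bits {bits : List Bool} (h : Interleave (bits.map .bit ++ G) H W) :
    ∃ W', W = bits ++ W' ∧ Interleave G H W' := by
  induction bits generalizing W with
  | nil => exact ⟨W, rfl, h⟩
  | cons b bits ih =>
    cases h with
    | bit _ h =>
      obtain ⟨W', rfl, h'⟩ := ih h
      exact ⟨W', rfl, h'⟩

end Interleave

namespace OneStreamMachine

variable {σ m : ℕ} (M : OneStreamMachine σ m)

/-- The computation from the given memory, head position and stream halts, with the given
steps. -/
inductive HaltingTrace : (Fin m → Bool) → ℤ → (ℤ → StreamCell σ M.Aux) →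
    List (StepRecord m) → Prop
  | halt {q h x} : M.trans q (x h) = none → HaltingTrace q h x []
  | step {q h x q' a bits mv tr} : M.trans q (x h) = some (q', a, bits, mv) →
      HaltingTrace q' (h + mv.offset) (Function.update x h a) tr →
      HaltingTrace q h x (⟨h, bits, q', h + mv.offset⟩ :: tr)

/-- The transcript `G` is consistent with the contents `x` of the region `J`, from the moment on
when the head is outside `J` (`none`) or at the given position in `J`, with the given memory. -/
inductive Sees (J : Set ℤ) : Option ((Fin m → Bool) × ℤ) → (ℤ → StreamCell σ M.Aux) →
    List (RegionEvent m) → Prop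
  | idle {x} : Sees J none x []
  | enter {q h x G} : h ∈ J → Sees J (some (q, h)) x G → Sees J none x (.hand q h :: G)
  | halt {q h x} : h ∈ J → M.trans q (x h) = none → Sees J (some (q, h)) x []
  | step {q h x q' a bits mv G} : h ∈ J → M.trans q (x h) = some (q', a, bits, mv) →
      h + mv.offset ∈ J → Sees J (some (q', h + mv.offset)) (Function.update x h a) G →
      Sees J (some (q, h)) x (bits.map .bit ++ G)
  | leave {q h x q' a bits mv G} : h ∈ J → M.trans q (x h) = some (q', a, bits, mv) →
      h + mv.offset ∉ J → Sees J none (Function.update x h a) G →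
      Sees J (some (q, h)) x (bits.map .bit ++ .hand q' (h + mv.offset) :: G)

variable {M}

/-- Only cells of `J` are ever read, and the same cells are overwritten in both streams. -/
theorem Sees.congr {J : Set ℤ} {s x G} (hs : M.Sees J s x G) :
    ∀ {y}, (∀ z ∈ J, x z = y z) → M.Sees J s y G := by
  have key : ∀ {x y : ℤ → StreamCell σ M.Aux} {h : ℤ} {a}, (∀ z ∈ J, x z = y z) →
      ∀ z ∈ J, Function.update x h a z = Function.update y h a z := by
    intro x y h a hxy z hz
    by_cases hzh : z = h
    · subst hzh; simp
    · simp [hzh, hxy z hz]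
  induction hs with
  | idle => exact fun _ => .idle
  | enter hJ _ ih => exact fun hxy => .enter hJ (ih hxy)
  | halt hJ ht => exact fun hxy => .halt hJ (hxy _ hJ ▸ ht)
  | step hJ ht hJ' _ ih => exact fun hxy => .step hJ (hxy _ hJ ▸ ht) hJ' (ih (key hxy))
  | leave hJ ht hJ' _ ih => exact fun hxy => .leave hJ (hxy _ hJ ▸ ht) hJ' (ih (key hxy))

-- Steps taken outside `J` do not touch the cells of `J`, so by `Sees.congr` the view from `J`
-- survives them.
open Classical in
theorem HaltingTrace.sees (J : Set ℤ) {q h x tr} (ht : M.HaltingTrace q h x tr) :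
    M.Sees J (if h ∈ J then some (q, h) else none) x (regionTranscript J tr) := by
  induction ht with
  | @halt q h x ht =>
    by_cases hJ : h ∈ J
    · simpa [hJ, regionTranscript] using Sees.halt hJ ht
    · simpa [hJ, regionTranscript] using Sees.idle
  | @step q h x q' a bits mv tr ht _ ih =>
    by_cases hJ : h ∈ J <;> by_cases hJ' : h + mv.offset ∈ J
    · rw [if_pos hJ'] at ih
      simpa [regionTranscript, StepRecord.events, hJ, hJ'] using Sees.step hJ ht hJ' ih
    · rw [if_neg hJ'] at ih
      simpa [regionTranscript, StepRecord.events, hJ, hJ'] using Sees.leave hJ ht hJ' ih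
    · have h1 : M.Sees J (some (q', h + mv.offset)) x (regionTranscript J tr) := by
        refine Sees.congr (by simpa [hJ'] using ih) fun z hz => ?_
        rw [Function.update_of_ne]
        rintro rfl
        exact hJ hz
      simpa [regionTranscript, StepRecord.events, hJ, hJ'] using Sees.enter hJ' h1
    · have h1 : M.Sees J none x (regionTranscript J tr) := by
        refine Sees.congr (by simpa [hJ'] using ih) fun z hz => ?_
        rw [Function.update_of_ne]
        rintro rfl
        exact hJ hz
      simpa [regionTranscript, StepRecord.events, hJ, hJ'] using h1

/-- The region is quantified inside the induction because `J` and its complement swap roles at each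
crossing. -/
theorem HaltingTrace.interleave {q h x tr} (ht : M.HaltingTrace q h x tr) :
    ∀ {J : Set ℤ}, h ∈ J →
    Interleave (regionTranscript J tr) (regionTranscript Jᶜ tr) (tr.flatMap (·.bits)) := by
  induction ht with
  | halt _ => exact fun _ => .nil
  | @step q h x q' a bits mv tr ht _ ih =>
    intro J hJ
    by_cases hJ' : h + mv.offset ∈ J
    · simpa [regionTranscript, StepRecord.events, hJ, hJ'] using (ih hJ').append_bits bits
    · have h1 := ih (J := Jᶜ) hJ'
      rw [compl_compl] at h1
      simpa [regionTranscript, StepRecord.events, hJ, hJ'] using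
        (Interleave.hand q' (h + mv.offset) h1).append_bits bits

theorem step_of_trans {c : M.Snapshot} {q' a bits mv}
    (ht : M.trans c.memory (c.stream c.head) = some (q', a, bits, mv)) :
    ∃ c', M.step c = some c' ∧ c'.memory = q' ∧ c'.head = c.head + mv.offset ∧
      c'.stream = Function.update c.stream c.head a ∧ c'.output = c.output ++ bits := by
  refine ⟨_, by rw [step, ht]; rfl, rfl, ?_, rfl, rfl⟩
  cases mv <;> simp [StreamMove.offset, sub_eq_add_neg]

/-- Two parties whose transcripts interleave make up a halting computation. -/
theorem Sees.reaches (N : ℕ) : ∀ {J : Set ℤ} {q h x y G H W},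
    G.length + H.length ≤ N → M.Sees J (some (q, h)) x G → M.Sees Jᶜ none y H →
    Interleave G H W → ∀ c : M.Snapshot, c.memory = q → c.head = h →
    (∀ z ∈ J, c.stream z = x z) → (∀ z ∉ J, c.stream z = y z) →
    ∃ c', StateTransition.Reaches M.step c c' ∧ M.step c' = none ∧ c'.output = c.output ++ W := by
  -- A step inside the region may leave no event, so such steps need the inner induction on the view
  -- of `J`. A crossing removes an event from both transcripts and swaps the parties; there the
  -- outer induction on the total length applies.
  induction N using Nat.strong_induction_on with
  | _ N ihN =>
    intro J q h x y G H W hN hG hH hW c hq hh hx hy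
    generalize hs : some (q, h) = s at hG
    induction hG generalizing q h W c with
    | idle => simp at hs
    | enter => simp at hs
    | @halt q h x hJ ht =>
      simp only [Option.some.injEq, Prod.mk.injEq] at hs
      obtain ⟨rfl, rfl⟩ := hs
      cases hW
      refine ⟨c, Relation.ReflTransGen.refl, ?_, by simp⟩
      rw [OneStreamMachine.step, hq, hh, hx _ hJ, ht]
      rfl
    | @step q h x q' a bits mv G hJ ht hJ' _ ih =>
      simp only [Option.some.injEq, Prod.mk.injEq] at hs
      obtain ⟨rfl, rfl⟩ := hs
      obtain ⟨W', rfl, hW'⟩ := hW.of_append_bits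
      obtain ⟨c₁, hc, hq₁, hh₁, hs₁, ho₁⟩ := step_of_trans (c := c) (q' := q') (a := a)
        (bits := bits) (mv := mv) (by rw [hq, hh, hx _ hJ, ht])
      rw [hh] at hh₁ hs₁
      obtain ⟨c', hr, hn, ho⟩ := ih (by simp at hN; omega) hW' c₁ hq₁ hh₁
        (fun z hz => by
          rw [hs₁]
          by_cases hzh : z = h <;> [simp [hzh]; simp [hzh, hx z hz]])
        (fun z hz => by
          rw [hs₁, Function.update_of_ne (by rintro rfl; exact hz hJ), hy z hz]) rfl
      exact ⟨c', Relation.ReflTransGen.head hc hr, hn, by rw [ho, ho₁, List.append_assoc]⟩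
    | @leave q h x q' a bits mv G hJ ht hJ' hG _ =>
      simp only [Option.some.injEq, Prod.mk.injEq] at hs
      obtain ⟨rfl, rfl⟩ := hs
      obtain ⟨W', rfl, hW'⟩ := hW.of_append_bits
      obtain ⟨c₁, hc, hq₁, hh₁, hs₁, ho₁⟩ := step_of_trans (c := c) (q' := q') (a := a)
        (bits := bits) (mv := mv) (by rw [hq, hh, hx _ hJ, ht])
      rw [hh] at hh₁ hs₁
      cases hW' with
      | @hand _ H _ _ _ hW' =>
      cases hH with
      | enter _ hH =>
      obtain ⟨c', hr, hn, ho⟩ := ihN (H.length + G.length) (by simp at hN; omega) le_rfl hH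
        (by rw [compl_compl]; exact hG) hW' c₁ hq₁ hh₁
        (fun z hz => by
          rw [hs₁, Function.update_of_ne (by rintro rfl; exact hz hJ), hy z hz])
        (fun z hz => by
          rw [hs₁]
          have hz : z ∈ J := by simpa using hz
          by_cases hzh : z = h <;> [simp [hzh]; simp [hzh, hx z hz]])
      exact ⟨c', Relation.ReflTransGen.head hc hr, hn, by rw [ho, ho₁, List.append_assoc]⟩

/-- Cut and paste: if two halting computations have the same transcript in the region `J`, and
the contents of `J` in the first are replaced by those in the second, then the output remains the
same. -/
theorem HaltingTrace.paste {J : Set ℤ} {q h x x' tr tr'} (ht : M.HaltingTrace q h x tr)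
    (ht' : M.HaltingTrace q h x' tr') (hJ : regionTranscript J tr = regionTranscript J tr')
    (c : M.Snapshot) (hq : c.memory = q) (hh : c.head = h) (hx' : ∀ z ∈ J, c.stream z = x' z)
    (hx : ∀ z ∉ J, c.stream z = x z) :
    ∃ c', StateTransition.Reaches M.step c c' ∧ M.step c' = none ∧
      c'.output = c.output ++ tr.flatMap (·.bits) := by
  -- The second run supplies the view from `J`, the first run the view from the complement. As the
  -- transcripts in `J` agree, the interleaving of the first run fits both.
  have h1 := ht'.sees J
  have h2 := ht.sees Jᶜ
  rw [← hJ] at h1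
  by_cases hhJ : h ∈ J
  · rw [if_pos hhJ] at h1
    rw [if_neg (by simpa using hhJ)] at h2
    exact Sees.reaches _ le_rfl h1 h2 (ht.interleave hhJ) c hq hh hx' hx
  · rw [if_neg hhJ] at h1
    rw [if_pos (by simpa using hhJ)] at h2
    have h3 := ht.interleave (J := Jᶜ) hhJ
    rw [compl_compl] at h3
    exact Sees.reaches _ le_rfl h2 (by rwa [compl_compl]) h3 c hq hh hx (by simpa using hx')

/-- How often the head crosses the border between the cells `a - 1` and `a`. -/
def _root_.borderCrossings (a : ℤ) (tr : List (StepRecord m)) : ℕ :=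
  tr.countP fun e => decide (e.source < a) != decide (e.target < a)

/-- Halting computations have traces. In the bound on the crossings of a border, the last term
is `0` if the head has already crossed the border in its current sweep. -/
theorem exists_haltingTrace {c c' : M.Snapshot} (hr : StateTransition.Reaches M.step c c')
    (hn : M.step c' = none) : ∃ tr, M.HaltingTrace c.memory c.head c.stream tr ∧
      c'.output = c.output ++ tr.flatMap (·.bits) ∧
      (∀ e ∈ tr, |e.target - e.source| ≤ 1) ∧
      ∀ a : ℤ, borderCrossings a tr + c.reversals ≤
        c'.reversals + if c.rightward = decide (c.head < a) then 1 else 0 := by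
  induction hr using Relation.ReflTransGen.head_induction_on with
  | refl =>
    refine ⟨[], .halt ?_, by simp, by simp, fun a => by simp [borderCrossings]⟩
    simpa [step] using hn
  | @head c c₁ hstep _ ih =>
    obtain ⟨tr, h1, h2, h3, h4⟩ := ih
    simp only [step, Option.mem_def, Option.map_eq_some_iff] at hstep
    obtain ⟨⟨q', a, bits, mv⟩, ht, rfl⟩ := hstep
    refine ⟨⟨c.head, bits, q', c.head + mv.offset⟩ :: tr, .step ht ?_, ?_, ?_, fun b => ?_⟩
    · cases mv <;> simpa [StreamMove.offset, sub_eq_add_neg] using h1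
    · simp [h2]
    · intro e he
      rcases List.mem_cons.1 he with rfl | he
      · cases mv <;> simp [StreamMove.offset]
      · exact h3 e he
    -- Potential argument: the last term is `1` exactly when the head is directed towards the
    -- border. A crossing spends it, and only a reversal can restore it.
    · have h5 := h4 b
      simp only [borderCrossings, List.countP_cons] at h5 ⊢
      cases mv <;> cases hrw : c.rightward <;>
        by_cases hb : c.head < b <;>
        simp only [StreamMove.offset, hrw, hb] at h5 ⊢ <;>
        first
          | (by_cases hb' : c.head - 1 < b <;> by_cases hb'' : c.head + 1 < b <;>
            simp [hb', hb'', ← sub_eq_add_neg, hb] at h5 ⊢ <;> omega)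

end OneStreamMachine

/-! ### Counting words -/

theorem ncard_length_eq (α : Type*) [Fintype α] (k : ℕ) :
    {l : List α | l.length = k}.ncard = Fintype.card α ^ k := by
  rw [← card_vector (α := α) k, ← Nat.card_eq_fintype_card]
  rfl

theorem finite_length_le (α : Type*) [Finite α] (k : ℕ) : {l : List α | l.length ≤ k}.Finite :=
  List.finite_length_le α k

theorem ncard_bits_length_le (N : ℕ) : {l : List Bool | l.length ≤ N}.ncard < 2 ^ (N + 1) := by
  induction N with
  | zero =>
    have h : {l : List Bool | l.length ≤ 0} = {[]} := by ext; simp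
    rw [h]
    simp
  | succ N ih =>
    have h : {l : List Bool | l.length ≤ N + 1} =
        {l : List Bool | l.length ≤ N} ∪ {l : List Bool | l.length = N + 1} := by
      ext; simp; omega
    have h1 := Set.ncard_union_le {l : List Bool | l.length ≤ N} {l : List Bool | l.length = N + 1}
    rw [ncard_length_eq, Fintype.card_bool] at h1
    rw [h, pow_succ]
    omega

/-! ### Periodic strings -/

theorem getElem?_flatten_replicate {α : Type*} (t : List α) (k j : ℕ) (hj : j < k * t.length) :
    (List.replicate k t).flatten[j]? = t[j % t.length]? := by
  induction k generalizing j with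
  | zero => simp at hj
  | succ k ih =>
    rw [List.replicate_succ, List.flatten_cons]
    rcases lt_or_ge j t.length with h | h
    · rw [List.getElem?_append_left h, Nat.mod_eq_of_lt h]
    · rw [List.getElem?_append_right h, ih _ (by rw [Nat.add_mul] at hj; omega),
        ← Nat.mod_eq_sub_mod h]

theorem length_periodicString {σ : ℕ} {t : List (Fin σ)} (ht : t ≠ []) (n : ℕ) :
    (periodicString t n).length = n := by
  have := List.length_pos_iff.2 ht
  simp only [periodicString, List.length_take, List.length_flatten, List.map_replicate,
    List.sum_replicate, smul_eq_mul]
  exact min_eq_left (Nat.le_mul_of_pos_right n this)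

theorem getElem?_periodicString {σ : ℕ} {t : List (Fin σ)} (ht : t ≠ []) {n j : ℕ} (hj : j < n) :
    (periodicString t n)[j]? = t[j % t.length]? := by
  have := List.length_pos_iff.2 ht
  rw [periodicString, List.getElem?_take_of_lt hj]
  exact getElem?_flatten_replicate t n j (hj.trans_le (Nat.le_mul_of_pos_right n this))

theorem getElem?_periodicString_block {σ : ℕ} {t : List (Fin σ)} {n i j : ℕ}
    (hj : j < t.length) (hi : (i + 1) * t.length ≤ n) :
    (periodicString t n)[i * t.length + j]? = t[j]? := by
  rw [getElem?_periodicString (by rintro rfl; simp at hj) (by rw [Nat.add_mul] at hi; omega)]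
  rw [Nat.mul_comm, Nat.mul_add_mod, Nat.mod_eq_of_lt hj]

/-! ### The size of transcripts -/

namespace RegionEvent

variable {m : ℕ}

/-- A binary code for the events at the cells `a, …, b - 1`. -/
def code (a b : ℤ) : RegionEvent m → List Bool
  | .bit c => [false, c]
  | .hand q h => true :: decide (h ≤ a) :: decide (a ≤ h ∧ h < b) :: List.ofFn q

/-- The head is next to one of the two borders of `a, …, b - 1`. -/
def Near (a b : ℤ) : RegionEvent m → Prop
  | .bit _ => True
  | .hand _ h => h = a - 1 ∨ h = a ∨ h = b - 1 ∨ h = b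

/-- The code is prefix-free on events near the borders: its two position flags separate the cells `a
- 1`, `a`, `b - 1`, `b`, where `a` and `b - 1` may coincide. -/
theorem code_append_inj {a b : ℤ} (hab : a < b) {e e' : RegionEvent m} (he : e.Near a b)
    (he' : e'.Near a b) {u u' : List Bool} (h : e.code a b ++ u = e'.code a b ++ u') :
    e = e' ∧ u = u' := by
  cases e with
  | bit c =>
    cases e' with
    | bit c' => simpa [code] using h
    | hand q' h' => simp [code] at h
  | hand q h₀ =>
    cases e' with
    | bit c' => simp [code] at h
    | hand q' h₀' =>
      simp only [code, List.cons_append, List.cons.injEq, decide_eq_decide, true_and] at h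
      obtain ⟨h1, h2, h3⟩ := h
      obtain ⟨h4, h5⟩ := List.append_inj h3 (by simp)
      have h6 := List.ofFn_injective h4
      simp only [Near] at he he'
      refine ⟨?_, h5⟩
      rw [h6]
      congr 1
      omega

theorem flatMap_code_inj {a b : ℤ} (hab : a < b) : ∀ {G G' : List (RegionEvent m)},
    (∀ e ∈ G, e.Near a b) → (∀ e ∈ G', e.Near a b) →
    G.flatMap (code a b) = G'.flatMap (code a b) → G = G' := by
  have hne : ∀ e : RegionEvent m, e.code a b ≠ [] := by rintro (_ | _) <;> simp [code]
  intro G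
  induction G with
  | nil =>
    rintro (_ | ⟨e', G'⟩) _ _ h
    · rfl
    · simp [hne] at h
  | cons e G ih =>
    rintro (_ | ⟨e', G'⟩) hG hG' h
    · simp [hne] at h
    · rw [List.flatMap_cons, List.flatMap_cons] at h
      obtain ⟨rfl, h1⟩ := code_append_inj hab (hG _ (by simp)) (hG' _ (by simp)) h
      rw [ih (fun e he => hG e (by simp [he])) (fun e he => hG' e (by simp [he])) h1]

end RegionEvent

open Classical in
/-- How many bits are output while the head is in the region `J`. -/
noncomputable def regionOutput {m : ℕ} (J : Set ℤ) (tr : List (StepRecord m)) : ℕ :=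
  (tr.map fun e => if e.source ∈ J then e.bits.length else 0).sum

theorem near_of_mem_regionTranscript {m : ℕ} {a b : ℤ} {tr : List (StepRecord m)}
    (htr : ∀ e ∈ tr, |e.target - e.source| ≤ 1) :
    ∀ e ∈ regionTranscript (Set.Ico a b) tr, e.Near a b := by
  intro e he
  obtain ⟨r, hr, he⟩ := List.mem_flatMap.1 he
  have h1 := abs_le.1 (htr r hr)
  rcases List.mem_append.1 he with he | he
  · split_ifs at he
    · obtain ⟨_, _, rfl⟩ := List.mem_map.1 he
      trivial
    · simp at he
  · split_ifs at he with h2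
    · simp at he
    · obtain rfl := List.mem_singleton.1 he
      simp only [Set.mem_Ico] at h2
      simp only [RegionEvent.Near]
      omega

/-- An output bit costs two bits of code. A `hand` event costs `m + 3` and requires a crossing of
border `a` or `b`. -/
theorem length_flatMap_code_le {m : ℕ} (a b : ℤ) (tr : List (StepRecord m)) :
    ((regionTranscript (Set.Ico a b) tr).flatMap (RegionEvent.code a b)).length ≤
      2 * regionOutput (Set.Ico a b) tr +
        (m + 3) * (borderCrossings a tr + borderCrossings b tr) := by
  induction tr with
  | nil => simp [regionTranscript]
  | cons e tr ih =>
    have h1 : ((e.events (Set.Ico a b)).flatMap (RegionEvent.code a b)).length ≤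
        2 * (if e.source ∈ Set.Ico a b then e.bits.length else 0) +
        (m + 3) * ((if (decide (e.source < a) != decide (e.target < a)) = true then 1 else 0) +
          if (decide (e.source < b) != decide (e.target < b)) = true then 1 else 0) := by
      have h2 : ∀ l : List Bool, ((l.map (.bit (m := m))).flatMap
          (RegionEvent.code a b)).length = 2 * l.length := by
        intro l
        induction l with
        | nil => rfl
        | cons c l ih =>
          rw [List.map_cons, List.flatMap_cons, List.length_append, ih]
          simp [RegionEvent.code]
          omega
      rw [StepRecord.events, List.flatMap_append, List.length_append]
      refine Nat.add_le_add ?_ ?_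
      · split_ifs
        · rw [h2]
        · simp
      · by_cases hx : (e.source ∈ Set.Ico a b ↔ e.target ∈ Set.Ico a b)
        · simp [hx]
        · rw [if_neg hx]
          have h3 : 1 ≤ ((if (decide (e.source < a) != decide (e.target < a)) = true then 1 else 0)
              + if (decide (e.source < b) != decide (e.target < b)) = true then 1 else 0) := by
            simp only [Set.mem_Ico] at hx
            by_cases h4 : e.source < a <;> by_cases h5 : e.target < a <;>
              by_cases h6 : e.source < b <;> by_cases h7 : e.target < b <;>
              simp [h4, h5, h6, h7] <;> omega
          refine le_trans ?_ (Nat.mul_le_mul_left _ h3)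
          simp [RegionEvent.code]
    rw [regionTranscript, List.flatMap_cons, List.flatMap_append, List.length_append]
    simp only [regionOutput, borderCrossings, regionTranscript, List.map_cons, List.sum_cons,
      List.countP_cons] at ih ⊢
    linarith

/-- The blocks are disjoint, so the bits of a step are charged to at most one of them. -/
theorem sum_regionOutput_le {m : ℕ} (ℓ k : ℕ) (tr : List (StepRecord m)) :
    ∑ i ∈ Finset.range k, regionOutput (Set.Ico ((i * ℓ : ℕ) : ℤ) (((i + 1) * ℓ : ℕ) : ℤ)) tr ≤
      (tr.flatMap (·.bits)).length := by
  classical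
  induction tr with
  | nil => simp [regionOutput]
  | cons e tr ih =>
    simp only [regionOutput, List.map_cons, List.sum_cons, Finset.sum_add_distrib,
      List.flatMap_cons, List.length_append] at ih ⊢
    refine Nat.add_le_add ?_ ih
    have h0 : (∑ i ∈ Finset.range k, if e.source ∈ Set.Ico ((i * ℓ : ℕ) : ℤ) (((i + 1) * ℓ : ℕ) : ℤ)
        then e.bits.length else 0) = ((Finset.range k).filter fun i => e.source ∈
          Set.Ico ((i * ℓ : ℕ) : ℤ) (((i + 1) * ℓ : ℕ) : ℤ)).card * e.bits.length := by
      rw [← smul_eq_mul, ← Finset.sum_const, Finset.sum_filter]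
    refine le_trans (le_of_eq ?_) (h0.le.trans ?_)
    · exact Finset.sum_congr rfl fun i _ => by congr
    refine le_trans (Nat.mul_le_mul_right _ (Finset.card_le_one.2 ?_)) (Nat.one_mul _).le
    have key : ∀ i j : ℕ, e.source ∈ Set.Ico ((i * ℓ : ℕ) : ℤ) (((i + 1) * ℓ : ℕ) : ℤ) →
        e.source ∈ Set.Ico ((j * ℓ : ℕ) : ℤ) (((j + 1) * ℓ : ℕ) : ℤ) → ¬ i < j := by
      intro i j hi hj hij
      have h1 : (((i + 1) * ℓ : ℕ) : ℤ) ≤ ((j * ℓ : ℕ) : ℤ) := by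
        exact_mod_cast Nat.mul_le_mul_right ℓ hij
      exact absurd (hi.2.trans_le (h1.trans hj.1)) (lt_irrefl _)
    intro i hi j hj
    have hi := (Finset.mem_filter.1 hi).2
    have hj := (Finset.mem_filter.1 hj).2
    have := key i j hi hj
    have := key j i hj hi
    omega

/-! ### Block transcripts of lossless machines, and the count of exceptional strings -/

namespace OneStreamMachine

variable {σ m : ℕ} {M : OneStreamMachine σ m}

theorem Outputs.unique {p : ℕ} {s : List (Fin σ)} {c : M.Snapshot} {w : List Bool}
    (h : M.Outputs p s w) (hr : StateTransition.Reaches M.step (M.start s) c)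
    (hn : M.step c = none) : c.output = w := by
  obtain ⟨c', hr', hn', rfl, -⟩ := h
  have h1 := StateTransition.mem_eval.2 ⟨hr, hn⟩
  have h2 := StateTransition.mem_eval.2 ⟨hr', hn'⟩
  rw [Part.mem_unique h1 h2]

theorem Outputs.exists_haltingTrace {p : ℕ} {s : List (Fin σ)} {w : List Bool}
    (h : M.Outputs p s w) : ∃ tr, M.HaltingTrace M.init 0 (M.start s).stream tr ∧
      w = tr.flatMap (·.bits) ∧ (∀ e ∈ tr, |e.target - e.source| ≤ 1) ∧
      ∀ a : ℤ, borderCrossings a tr ≤ 2 * p := by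
  obtain ⟨c', hr', hn', rfl, hc⟩ := h
  obtain ⟨tr, h1, h2, h3, h4⟩ := OneStreamMachine.exists_haltingTrace hr' hn'
  refine ⟨tr, h1, by simpa [start] using h2, h3, fun a => ?_⟩
  have h5 := h4 a
  simp only [start] at h5
  -- At most `2 * p - 1` reversals, plus one crossing that no reversal has to precede.
  have h6 : borderCrossings a tr + 0 ≤ c'.reversals + 1 :=
    h5.trans (Nat.add_le_add_left (ite_le_one le_rfl zero_le_one) _)
  omega

/-- The crux. Losslessness is applied to `periodicString t n` and a hybrid that has `t'` in block
`i` only. The hybrid is usually not periodic, so losslessness on periodic strings alone would not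
do. -/
theorem IsLossless.eq_of_regionTranscript_eq {p n : ℕ} (hM : M.IsLossless p n) {ℓ i : ℕ}
    (hi : (i + 1) * ℓ ≤ n) {t t' : List (Fin σ)} (ht : t.length = ℓ) (ht' : t'.length = ℓ)
    {tr tr' : List (StepRecord m)}
    (htr : M.HaltingTrace M.init 0 (M.start (periodicString t n)).stream tr)
    (htr' : M.HaltingTrace M.init 0 (M.start (periodicString t' n)).stream tr')
    (hw : M.Outputs p (periodicString t n) (tr.flatMap (·.bits)))
    (hG : regionTranscript (Set.Ico ((i * ℓ : ℕ) : ℤ) (((i + 1) * ℓ : ℕ) : ℤ)) tr =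
      regionTranscript (Set.Ico ((i * ℓ : ℕ) : ℤ) (((i + 1) * ℓ : ℕ) : ℤ)) tr') :
    t = t' := by
  rcases Nat.eq_zero_or_pos ℓ with rfl | hℓ
  · rw [List.length_eq_zero_iff.1 ht, List.length_eq_zero_iff.1 ht']
  have hne : t ≠ [] := by rintro rfl; simp at ht; omega
  have hne' : t' ≠ [] := by rintro rfl; simp at ht'; omega
  have hl := length_periodicString hne n
  have hl' := length_periodicString hne' n
  set s := periodicString t n with hs
  set s' := periodicString t' n with hs'
  -- The hybrid: `s` with its block `i` taken from `s'`.
  let u : List (Fin σ) := List.ofFn fun j : Fin n =>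
    if i * ℓ ≤ j ∧ j < (i + 1) * ℓ then s'[(j : ℕ)]'(by omega) else s[(j : ℕ)]'(by omega)
  have hu : u.length = n := by simp [u]
  have hget : ∀ j : ℕ, u[j]? = if i * ℓ ≤ j ∧ j < (i + 1) * ℓ then s'[j]? else s[j]? := by
    intro j
    rcases lt_or_ge j n with hj | hj
    · rw [List.getElem?_eq_getElem (by omega), List.getElem?_eq_getElem (l := s) (by omega),
        List.getElem?_eq_getElem (l := s') (by omega)]
      simp only [u, List.getElem_ofFn]
      split_ifs <;> rfl
    · rw [List.getElem?_eq_none (by omega), List.getElem?_eq_none (l := s) (by omega),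
        List.getElem?_eq_none (l := s') (by omega), ite_self]
  obtain ⟨c, hr, hn, ho⟩ := htr.paste htr' hG (M.start u) rfl rfl
    (fun z hz => by
      have h0 : 0 ≤ z := le_trans (by positivity) hz.1
      lift z to ℕ using h0
      have h1 : i * ℓ ≤ z ∧ z < (i + 1) * ℓ := by
        rw [Set.mem_Ico] at hz
        exact_mod_cast hz
      simp [start, hget, h1])
    (fun z hz => by
      by_cases h0 : 0 ≤ z
      · lift z to ℕ using h0
        have h1 : ¬ (i * ℓ ≤ z ∧ z < (i + 1) * ℓ) := by
          rw [Set.mem_Ico] at hz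
          exact_mod_cast hz
        simp only [start, Nat.cast_nonneg, if_true, Int.toNat_natCast, hget, h1, if_false]
      · simp [start, h0])
  obtain ⟨w, hwu⟩ := hM.1 u hu
  have h1 := hwu.unique hr hn
  rw [ho] at h1
  have h2 : u = s := hM.2 u s _ hu hl hwu (by rw [← h1]; simpa [start] using hw)
  refine List.ext_getElem? fun j => ?_
  rcases lt_or_ge j ℓ with hj | hj
  · have h3 : s[i * ℓ + j]? = t[j]? := by
      have := getElem?_periodicString_block (t := t) (n := n) (i := i) (j := j) (by omega)
        (by rwa [ht])
      rwa [ht] at this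
    have h4 : s'[i * ℓ + j]? = t'[j]? := by
      have := getElem?_periodicString_block (t := t') (n := n) (i := i) (j := j) (by omega)
        (by rwa [ht'])
      rwa [ht'] at this
    rw [← h3, ← h4, ← h2, hget, if_pos ⟨by omega, by rw [Nat.add_mul]; omega⟩]
  · rw [List.getElem?_eq_none (by omega), List.getElem?_eq_none (by omega)]

/-- Few strings are such that a lossless machine outputs few bits on most of their copies. -/
theorem IsLossless.ncard_le {p n : ℕ} (hM : M.IsLossless p n) {ℓ k : ℕ} (hℓ : 0 < ℓ)
    (hk : 0 < k) (hkn : k * ℓ ≤ n) (L : ℕ) :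
    {t : List (Fin σ) | t.length = ℓ ∧ ∃ w : List Bool, M.Outputs p (periodicString t n) w ∧
      2 * w.length ≤ (L + 1) * k}.ncard ≤ 2 ^ (2 * L + (m + 3) * (4 * p) + 2) := by
  classical
  have h0 : ∀ t : List (Fin σ), ∃ tr, t.length = ℓ →
      M.Outputs p (periodicString t n) (tr.flatMap (·.bits)) ∧
      M.HaltingTrace M.init 0 (M.start (periodicString t n)).stream tr ∧
      (∀ e ∈ tr, |e.target - e.source| ≤ 1) ∧ ∀ a : ℤ, borderCrossings a tr ≤ 2 * p := by
    intro t
    by_cases ht : t.length = ℓ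
    · obtain ⟨w, hw⟩ := hM.1 (periodicString t n)
        (length_periodicString (by rintro rfl; simp at ht; omega) n)
      obtain ⟨tr, h1, rfl, h3, h4⟩ := hw.exists_haltingTrace
      exact ⟨tr, fun _ => ⟨hw, h1, h3, h4⟩⟩
    · exact ⟨[], fun h => absurd h ht⟩
  choose tr htr using h0
  set B : Set (List (Fin σ)) := {t : List (Fin σ) | t.length = ℓ ∧ ∃ w : List Bool,
    M.Outputs p (periodicString t n) w ∧ 2 * w.length ≤ (L + 1) * k} with hB
  have hfin : B.Finite := (List.finite_length_eq (Fin σ) ℓ).subset fun t ht => ht.1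
  set J : ℕ → Set ℤ := fun i => Set.Ico ((i * ℓ : ℕ) : ℤ) (((i + 1) * ℓ : ℕ) : ℤ) with hJ
  set N := 2 * L + (m + 3) * (4 * p) with hN
  -- For a fixed block, the code of the transcript is injective in `t` and has at most `N` bits.
  have hblock : ∀ i ∈ Finset.range k,
      (hfin.toFinset.filter fun t => regionOutput (J i) (tr t) ≤ L).card ≤ 2 ^ (N + 1) := by
    intro i hi
    have hik : (i + 1) * ℓ ≤ n :=
      (Nat.mul_le_mul_right ℓ (Finset.mem_range.1 hi)).trans hkn
    rw [← Set.ncard_coe_finset]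
    refine le_trans (Set.ncard_le_ncard_of_injOn (t := {l : List Bool | l.length ≤ N})
      (fun t => (regionTranscript (J i) (tr t)).flatMap
        (RegionEvent.code ((i * ℓ : ℕ) : ℤ) (((i + 1) * ℓ : ℕ) : ℤ))) ?_ ?_
        (finite_length_le Bool N)) (ncard_bits_length_le N).le
    · intro t ht
      simp only [Finset.coe_filter, Set.Finite.mem_toFinset, Set.mem_ofPred_eq] at ht ⊢
      obtain ⟨-, -, -, h4⟩ := htr t ht.1.1
      refine (length_flatMap_code_le _ _ _).trans ?_
      refine Nat.add_le_add (Nat.mul_le_mul_left 2 ht.2) (Nat.mul_le_mul_left _ ?_)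
      have := h4 ((i * ℓ : ℕ) : ℤ)
      have := h4 (((i + 1) * ℓ : ℕ) : ℤ)
      omega
    · intro t ht t' ht' h
      simp only [Finset.coe_filter, Set.Finite.mem_toFinset, Set.mem_ofPred_eq] at ht ht'
      obtain ⟨h1, h2, h3, -⟩ := htr t ht.1.1
      obtain ⟨-, h2', h3', -⟩ := htr t' ht'.1.1
      refine hM.eq_of_regionTranscript_eq hik ht.1.1 ht'.1.1 h2 h2' h1 ?_
      refine RegionEvent.flatMap_code_inj ?_ (near_of_mem_regionTranscript h3)
        (near_of_mem_regionTranscript h3') h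
      rw [Nat.add_mul]
      push_cast
      omega
  -- Markov's inequality: the other blocks output at least `L + 1` bits each, so they number at most
  -- `k / 2`.
  have hstr : ∀ t ∈ hfin.toFinset,
      k ≤ 2 * ((Finset.range k).filter fun i => regionOutput (J i) (tr t) ≤ L).card := by
    intro t ht
    obtain ⟨ht, w, hw, hwL⟩ := hfin.mem_toFinset.1 ht
    obtain ⟨⟨c, hr, hn, ho, -⟩, -⟩ := htr t ht
    have h1 := hw.unique hr hn
    rw [ho] at h1
    have h2 := sum_regionOutput_le ℓ k (tr t)
    rw [h1] at h2
    have h3 : ((Finset.range k).filter fun i => ¬ regionOutput (J i) (tr t) ≤ L).card * (L + 1) ≤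
        w.length := by
      refine le_trans ?_ h2
      rw [← smul_eq_mul]
      refine le_trans (Finset.card_nsmul_le_sum _ (fun i => regionOutput (J i) (tr t)) _ ?_)
        (Finset.sum_le_sum_of_subset (Finset.filter_subset _ _))
      intro i hi
      have := (Finset.mem_filter.1 hi).2
      omega
    have h4 := Finset.card_filter_add_card_filter_not (s := Finset.range k)
      (fun i => regionOutput (J i) (tr t) ≤ L)
    rw [Finset.card_range] at h4
    have h5 : 2 * ((Finset.range k).filter fun i => ¬ regionOutput (J i) (tr t) ≤ L).card ≤ k := by
      refine Nat.le_of_mul_le_mul_left ?_ (Nat.succ_pos L)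
      rw [Nat.succ_eq_add_one]
      nlinarith
    omega
  -- Double counting of the pairs of an exceptional string and a block with little output.
  have h1 : hfin.toFinset.card * k ≤ 2 * (k * 2 ^ (N + 1)) := by
    calc hfin.toFinset.card * k = ∑ _t ∈ hfin.toFinset, k := by simp
      _ ≤ ∑ t ∈ hfin.toFinset,
          2 * ((Finset.range k).filter fun i => regionOutput (J i) (tr t) ≤ L).card :=
        Finset.sum_le_sum hstr
      _ = 2 * ∑ t ∈ hfin.toFinset, ((Finset.range k).filter
          fun i => regionOutput (J i) (tr t) ≤ L).card := by rw [Finset.mul_sum]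
      _ = 2 * ∑ i ∈ Finset.range k, (hfin.toFinset.filter
          fun t => regionOutput (J i) (tr t) ≤ L).card := by
        congr 1
        exact Finset.sum_card_bipartiteAbove_eq_sum_card_bipartiteBelow
          (fun t i => regionOutput (J i) (tr t) ≤ L)
      _ ≤ 2 * ∑ _i ∈ Finset.range k, 2 ^ (N + 1) :=
        Nat.mul_le_mul_left 2 (Finset.sum_le_sum hblock)
      _ = 2 * (k * 2 ^ (N + 1)) := by simp
  rw [Set.ncard_eq_toFinset_card B hfin]
  refine Nat.le_of_mul_le_mul_right (h1.trans (le_of_eq ?_)) hk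
  rw [pow_succ 2 (N + 1)]
  ring

end OneStreamMachine

/-! ### A small grammar for periodic strings -/

namespace WrittenGrammar

variable {σ : ℕ}

/-- The string that a symbol stands for, if `v` is the value of the nonterminals. -/
def symbolValue (v : ℕ → List (Fin σ)) : Symbol (Fin σ) ℕ → List (Fin σ)
  | .terminal a => [a]
  | .nonterminal i => v i

theorem flatMap_symbolValue_terminal (v : ℕ → List (Fin σ)) (w : List (Fin σ)) :
    (w.map .terminal).flatMap (symbolValue v) = w := by
  induction w with
  | nil => rfl
  | cons a w ih => simpa [symbolValue] using ih

/-- If the productions preserve the values of the symbols, then only the value of the start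
symbol is generated. -/
theorem generatesOnly_of_value (G : WrittenGrammar σ) (v : ℕ → List (Fin σ))
    (hv : ∀ r ∈ G.rules, v r.input = r.output.flatMap (symbolValue v))
    (hd : G.toCFG.Derives [Symbol.nonterminal G.start] ((v G.start).map .terminal)) :
    G.GeneratesOnly (v G.start) := by
  have key : ∀ u : List (Symbol (Fin σ) ℕ), G.toCFG.Derives [Symbol.nonterminal G.start] u →
      u.flatMap (symbolValue v) = v G.start := by
    intro u hu
    induction hu with
    | refl => exact List.append_nil _
    | tail _ hstep ih =>
      obtain ⟨r, hr, hrw⟩ := hstep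
      obtain ⟨a, b, rfl, rfl⟩ := hrw.exists_parts
      rw [← ih]
      have h1 := hv r ((List.mem_toFinset (α := ContextFreeRule (Fin σ) ℕ)).1 hr)
      erw [List.flatMap_append, List.flatMap_append, List.flatMap_append, List.flatMap_append]
      congr 2
      rw [← h1]
      exact (List.append_nil _).symm
  refine Set.ext fun w => ⟨fun hw => ?_, fun hw => ?_⟩
  · have h1 := key _ hw
    exact (flatMap_symbolValue_terminal v w).symm.trans h1
  · obtain rfl : w = v G.start := hw
    exact hd

/-- Derivations, with the nonterminals as plain numbers. -/
def Derives (G : WrittenGrammar σ) (u v : List (Symbol (Fin σ) ℕ)) : Prop :=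
  G.toCFG.Derives u v

namespace Derives

variable {G : WrittenGrammar σ} {u u' v v' : List (Symbol (Fin σ) ℕ)}

theorem refl (u : List (Symbol (Fin σ) ℕ)) : G.Derives u u :=
  Relation.ReflTransGen.refl

theorem trans {w : List (Symbol (Fin σ) ℕ)} (h : G.Derives u v) (h' : G.Derives v w) :
    G.Derives u w :=
  Relation.ReflTransGen.trans h h'

theorem of_mem {i : ℕ} {o : List (Symbol (Fin σ) ℕ)} (h : ⟨i, o⟩ ∈ G.rules) :
    G.Derives [.nonterminal i] o :=
  .single ⟨⟨i, o⟩, (List.mem_toFinset (α := ContextFreeRule (Fin σ) ℕ)).2 h,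
    ContextFreeRule.Rewrites.input_output⟩

theorem append (hu : G.Derives u u') (hv : G.Derives v v') : G.Derives (u ++ v) (u' ++ v') :=
  (ContextFreeGrammar.Derives.append_right hu v).trans
    (ContextFreeGrammar.Derives.append_left hv u')

end Derives

/-- The right-hand side that doubles the nonterminal `i` and appends the nonterminal `1` if `b`. -/
def doubling (i : ℕ) (b : Bool) : List (Symbol (Fin σ) ℕ) :=
  [.nonterminal i] ++ [.nonterminal i] ++ if b then [.nonterminal 1] else []

/-- A grammar for `q` copies of `t`, followed by `u`, with `D` doublings. -/
def power (t u : List (Fin σ)) (q D : ℕ) : WrittenGrammar σ where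
  start := 0
  rules := [⟨0, [.nonterminal 2] ++ u.map .terminal⟩, ⟨1, t.map .terminal⟩, ⟨2 + D, []⟩] ++
    (List.range D).map fun j => ⟨2 + j, doubling (3 + j) (q.testBit j)⟩

/-- The values of the nonterminals. -/
def powerValue (t u : List (Fin σ)) (q : ℕ) : ℕ → List (Fin σ)
  | 0 => (List.replicate q t).flatten ++ u
  | 1 => t
  | j + 2 => (List.replicate (q / 2 ^ j) t).flatten

/-- Horner's scheme in binary: `q / 2 ^ j` is twice `q / 2 ^ (j + 1)` plus bit `j` of `q`. -/
theorem powerValue_doubling (t u : List (Fin σ)) (q j : ℕ) :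
    powerValue t u q (2 + j) =
      (doubling (3 + j) (q.testBit j)).flatMap (symbolValue (powerValue t u q)) := by
  have h1 : q / 2 ^ j = q / 2 ^ (j + 1) + q / 2 ^ (j + 1) + (q.testBit j).toNat := by
    have h2 := Nat.div_add_mod (q / 2 ^ j) 2
    rw [Nat.toNat_testBit, pow_succ, ← Nat.div_div_eq_div_mul]
    omega
  have h3 : 3 + j = j + 1 + 2 := by omega
  rw [h3, Nat.add_comm 2 j]
  simp only [doubling, powerValue, List.flatMap_append, List.flatMap_singleton, symbolValue]
  rw [h1, List.replicate_add, List.replicate_add, List.flatten_append, List.flatten_append]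
  cases q.testBit j <;> simp [powerValue, symbolValue]

/-- The nonterminal `2 + j` stands for `q / 2 ^ j` copies of `t`. By `hD` the last one, `2 + D`,
stands for the empty string, as its production says. -/
theorem power_generatesOnly (t u : List (Fin σ)) {q D : ℕ} (hD : q < 2 ^ D) :
    (power t u q D).GeneratesOnly ((List.replicate q t).flatten ++ u) := by
  have hval : ∀ r ∈ (power t u q D).rules,
      powerValue t u q r.input = r.output.flatMap (symbolValue (powerValue t u q)) := by
    intro r hr
    rcases List.mem_append.1 hr with hr | hr
    · simp only [List.mem_cons, List.not_mem_nil, or_false] at hr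
      rcases hr with rfl | rfl | rfl
      · rw [List.flatMap_append, flatMap_symbolValue_terminal]
        simp [symbolValue, powerValue]
      · exact (flatMap_symbolValue_terminal _ _).symm
      · rw [Nat.add_comm 2 D]
        simp [powerValue, Nat.div_eq_of_lt hD]
    · obtain ⟨j, -, rfl⟩ := List.mem_map.1 hr
      exact powerValue_doubling t u q j
  refine generatesOnly_of_value _ (powerValue t u q) hval ?_
  show (power t u q D).Derives _ _
  have hone : (power t u q D).Derives [Symbol.nonterminal 1] (t.map .terminal) :=
    Derives.of_mem (by simp [power])
  -- Induction from the bottom of the chain upwards; `i` is the number of doublings still below `j`.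
  have hdouble : ∀ i j : ℕ, i + j = D → (power t u q D).Derives
      [Symbol.nonterminal (2 + j)] ((powerValue t u q (2 + j)).map .terminal) := by
    intro i
    induction i with
    | zero =>
      intro j hj
      obtain rfl : j = D := by omega
      rw [Nat.add_comm 2 j]
      simp only [powerValue, Nat.div_eq_of_lt hD]
      exact Derives.of_mem (by simp [power, Nat.add_comm])
    | succ i ih =>
      intro j hj
      have h1 := ih (j + 1) (by omega)
      have h3 : 2 + (j + 1) = 3 + j := by omega
      rw [h3] at h1
      refine (Derives.of_mem (o := doubling (3 + j) (q.testBit j)) ?_).trans ?_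
      · refine List.mem_append_right _ (List.mem_map.2 ⟨j, List.mem_range.2 (by omega), rfl⟩)
      · rw [powerValue_doubling, doubling, List.flatMap_append, List.flatMap_append,
          List.map_append, List.map_append]
        refine Derives.append (Derives.append ?_ ?_) ?_
        · simpa [symbolValue] using h1
        · simpa [symbolValue] using h1
        · cases q.testBit j
          · exact .refl _
          · simpa [symbolValue, powerValue] using hone
  refine (Derives.of_mem (i := 0) (o := [.nonterminal 2] ++ u.map .terminal)
    (by simp [power])).trans ?_
  have h1 : powerValue t u q (power t u q D).start = powerValue t u q 2 ++ u := by
    simp [powerValue, power]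
  rw [h1, List.map_append]
  exact Derives.append (hdouble D 0 (by omega)) (.refl _)

theorem length_toBits (G : WrittenGrammar σ) :
    G.toBits.length = G.width + 1 + G.codes.length * G.width := by
  have h : ∀ l : List ℕ, (l.flatMap fun x => (List.range G.width).map x.testBit).length =
      l.length * G.width := by
    intro l
    induction l with
    | nil => simp
    | cons x l ih =>
      rw [List.flatMap_cons, List.length_append, ih]
      simp
      ring
  simp [toBits, h]
  ring

/-- The crude `B < 2 ^ B` is enough, since the codes used here are themselves only logarithmic in
`n`. -/
theorem width_le {G : WrittenGrammar σ} {B : ℕ} (h : ∀ x ∈ G.codes, x ≤ B) : G.width ≤ B := by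
  have h1 : ∀ l : List ℕ, (∀ x ∈ l, x ≤ B) → l.foldr max 0 ≤ B := by
    intro l
    induction l with
    | nil => simp
    | cons x l ih =>
      intro h
      exact max_le (h x (by simp)) (ih fun y hy => h y (by simp [hy]))
  refine (Nat.size_le.2 ?_)
  exact (h1 _ h).trans_lt Nat.lt_two_pow_self

theorem smallestGrammarSize_le {s : List (Fin σ)} {G : WrittenGrammar σ} (h : G.GeneratesOnly s) :
    smallestGrammarSize s ≤ G.toBits.length :=
  Nat.sInf_le ⟨G, h, rfl⟩

/-- The largest code, `σ + D + 3`, is that of the nonterminal `2 + D`. Each doubling takes at most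
five codes: left-hand side, at most three symbols, end mark. -/
theorem length_power_toBits_le (t u : List (Fin σ)) (q D : ℕ) :
    (power t u q D).toBits.length ≤
      (σ + D + 4) * (t.length + u.length + 5 * D + 12) := by
  have hw : (power t u q D).width ≤ σ + D + 3 := by
    refine width_le fun x hx => ?_
    have hterm : ∀ l : List (Fin σ), x ∈ (l.map .terminal).map symbolCode → x ≤ σ := by
      intro l hl
      simp only [List.map_map, List.mem_map] at hl
      obtain ⟨a, -, rfl⟩ := hl
      exact a.isLt
    rcases List.mem_cons.1 hx with rfl | hx
    · simp only [power, symbolCode]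
      omega
    obtain ⟨r, hr, hx⟩ := List.mem_flatMap.1 hx
    rcases List.mem_append.1 hr with hr | hr
    · simp only [List.mem_cons, List.not_mem_nil, or_false] at hr
      rcases hr with rfl | rfl | rfl
      · rw [List.map_append, List.mem_cons, List.mem_append, List.mem_append] at hx
        rcases hx with rfl | (hx | hx) | hx
        · simp only [symbolCode]; omega
        · simp [symbolCode] at hx; omega
        · have := hterm u hx; omega
        · simp at hx; omega
      · rw [List.mem_cons, List.mem_append] at hx
        rcases hx with rfl | hx | hx
        · simp only [symbolCode]; omega
        · have := hterm t hx; omega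
        · simp at hx; omega
      · simp [symbolCode] at hx; omega
    · obtain ⟨j, hj, rfl⟩ := List.mem_map.1 hr
      have := List.mem_range.1 hj
      cases hb : q.testBit j <;> simp [symbolCode, doubling, hb] at hx <;> omega
  have hc : (power t u q D).codes.length ≤ t.length + u.length + 5 * D + 10 := by
    have h1 : ∀ l : List ℕ, ((l.map fun j => (⟨2 + j, doubling (3 + j) (q.testBit j)⟩ :
        ContextFreeRule (Fin σ) ℕ)).flatMap fun r => symbolCode (σ := σ) (.nonterminal r.input) ::
          (r.output.map symbolCode ++ [0])).length ≤ 5 * l.length := by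
      intro l
      induction l with
      | nil => simp
      | cons j l ih =>
        rw [List.map_cons, List.flatMap_cons, List.length_append, List.length_cons (as := l)]
        have : (doubling (σ := σ) (3 + j) (q.testBit j)).length ≤ 3 := by
          cases hb : q.testBit j <;> simp [doubling]
        simp only [List.length_cons, List.length_append, List.length_map, List.length_nil]
        omega
    have h2 := h1 (List.range D)
    rw [List.length_range] at h2
    rw [codes, power, List.flatMap_append, List.length_cons, List.length_append]
    refine (Nat.add_le_add_right (Nat.add_le_add_left h2 _) _).trans ?_
    simp
    omega
  rw [length_toBits]
  nlinarith

theorem smallestGrammarSize_periodicString_le {t : List (Fin σ)} (ht : t ≠ []) (n : ℕ) :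
    smallestGrammarSize (periodicString t n) ≤
      (σ + n.size + 4) * (2 * t.length + 5 * n.size + 12) := by
  have hpos := List.length_pos_iff.2 ht
  have h : periodicString t n =
      (List.replicate (n / t.length) t).flatten ++ t.take (n % t.length) := by
    have hn := Nat.div_add_mod n t.length
    have hmod := Nat.mod_lt n hpos
    refine List.ext_getElem? fun j => ?_
    have hl : (List.replicate (n / t.length) t).flatten.length = n / t.length * t.length := by
      simp
    rcases lt_or_ge j n with hj | hj
    · rw [getElem?_periodicString ht hj]
      rcases lt_or_ge j (n / t.length * t.length) with h1 | h1
      · rw [List.getElem?_append_left (by rw [hl]; exact h1), getElem?_flatten_replicate _ _ _ h1]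
      · rw [List.getElem?_append_right (by rw [hl]; exact h1), hl,
          List.getElem?_take_of_lt (by rw [Nat.mul_comm]; rw [Nat.mul_comm] at h1; omega)]
        congr 1
        rw [Nat.mul_comm] at h1 ⊢
        obtain ⟨i, rfl⟩ := Nat.exists_eq_add_of_le h1
        rw [Nat.mul_add_mod, Nat.add_sub_cancel_left, Nat.mod_eq_of_lt (by omega)]
    · rw [List.getElem?_eq_none (by rw [length_periodicString ht]; exact hj),
        List.getElem?_eq_none]
      rw [List.length_append, hl, List.length_take, min_eq_left hmod.le, Nat.mul_comm, hn]
      exact hj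
  rw [h]
  -- Hence `n.size` doublings suffice, whatever the length of `t`.
  have hD : n / t.length < 2 ^ n.size := (Nat.div_le_self _ _).trans_lt (Nat.lt_size_self n)
  refine (smallestGrammarSize_le (power_generatesOnly t _ hD)).trans
    ((length_power_toBits_le _ _ _ _).trans ?_)
  refine Nat.mul_le_mul_left _ ?_
  have : (t.take (n % t.length)).length ≤ t.length := by simp
  omega

end WrittenGrammar

/-! ### Decoding -/

theorem append_cons_inj_of_notMem {α : Type*} {x : α} {a b u v : List α} (ha : x ∉ a)
    (hb : x ∉ b) (h : a ++ x :: u = b ++ x :: v) : a = b ∧ u = v := by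
  induction a generalizing b with
  | nil =>
    cases b with
    | nil => simpa using h
    | cons y b =>
      simp only [List.nil_append, List.cons_append, List.cons.injEq] at h
      exact absurd (h.1 ▸ List.mem_cons_self) hb
  | cons y a ih =>
    cases b with
    | nil =>
      simp only [List.nil_append, List.cons_append, List.cons.injEq] at h
      exact absurd (h.1 ▸ List.mem_cons_self) ha
    | cons z b =>
      simp only [List.cons_append, List.cons.injEq] at h
      obtain ⟨rfl, h⟩ := h
      obtain ⟨rfl, rfl⟩ := ih (fun h' => ha (List.mem_cons_of_mem _ h'))
        (fun h' => hb (List.mem_cons_of_mem _ h')) h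
      exact ⟨rfl, rfl⟩

theorem replicate_true_append_inj {i j : ℕ} {u v : List Bool}
    (h : List.replicate i true ++ false :: u = List.replicate j true ++ false :: v) :
    i = j ∧ u = v := by
  obtain ⟨h1, h2⟩ := append_cons_inj_of_notMem (by simp) (by simp) h
  exact ⟨by simpa using congrArg List.length h1, h2⟩

namespace WrittenGrammar

variable {σ : ℕ}

theorem symbolCode_injective : Function.Injective (symbolCode (σ := σ)) := by
  rintro (a | i) (b | j) h
  · simp only [symbolCode, Nat.add_right_cancel_iff] at h
    rw [Fin.ext h]
  · have := a.isLt
    simp only [symbolCode] at h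
    omega
  · have := b.isLt
    simp only [symbolCode] at h
    omega
  · simp only [symbolCode, Nat.add_left_cancel_iff] at h
    rw [h]

theorem symbolCode_ne_zero (x : Symbol (Fin σ) ℕ) : 0 ≠ symbolCode x := by
  cases x <;> simp only [symbolCode] <;> omega

/-- No symbol has code `0`, so the end marks show where each production stops. -/
theorem codes_injective : Function.Injective (codes (σ := σ)) := by
  rintro ⟨s, R⟩ ⟨s', R'⟩ h
  simp only [codes, List.cons.injEq] at h
  obtain ⟨h1, h2⟩ := h
  have h3 := symbolCode_injective h1
  simp only [Symbol.nonterminal.injEq] at h3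
  subst h3
  congr 1
  clear h1
  induction R generalizing R' with
  | nil =>
    cases R' with
    | nil => rfl
    | cons r' R' => simp at h2
  | cons r R ih =>
    cases R' with
    | nil => simp at h2
    | cons r' R' =>
      rw [List.flatMap_cons, List.flatMap_cons, List.cons_append, List.cons_append,
        List.append_assoc, List.append_assoc, List.cons.injEq] at h2
      obtain ⟨h4, h5⟩ := h2
      have hz : ∀ l : List (Symbol (Fin σ) ℕ), 0 ∉ l.map symbolCode := by
        intro l hl
        obtain ⟨x, -, hx⟩ := List.mem_map.1 hl
        exact symbolCode_ne_zero x hx.symm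
      obtain ⟨h6, h7⟩ := append_cons_inj_of_notMem (hz _) (hz _) h5
      have h8 := symbolCode_injective h4
      simp only [Symbol.nonterminal.injEq] at h8
      have h9 := List.map_injective_iff.2 symbolCode_injective h6
      rw [ih _ h7]
      congr 1
      cases r
      cases r'
      simp only at h8 h9
      rw [h8, h9]

/-- Fixed-width words can be cut apart. Width `0` is excluded because it would hide the length of
the list. -/
theorem binary_flatMap_inj {w : ℕ} (hw : 0 < w) : ∀ {l l' : List ℕ}, (∀ x ∈ l, x < 2 ^ w) →
    (∀ x ∈ l', x < 2 ^ w) → (l.flatMap fun x => (List.range w).map x.testBit) =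
      (l'.flatMap fun x => (List.range w).map x.testBit) → l = l' := by
  intro l
  have hne : ∀ x : ℕ, (List.range w).map x.testBit ≠ [] := by
    intro x h
    simp at h
    omega
  induction l with
  | nil =>
    rintro (_ | ⟨x', l'⟩) _ _ h
    · rfl
    · rw [List.flatMap_cons] at h
      exact absurd (List.append_eq_nil_iff.1 h.symm).1 (hne _)
  | cons x l ih =>
    rintro (_ | ⟨x', l'⟩) hl hl' h
    · rw [List.flatMap_cons] at h
      exact absurd (List.append_eq_nil_iff.1 h).1 (hne _)
    · rw [List.flatMap_cons, List.flatMap_cons] at h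
      obtain ⟨h1, h2⟩ := List.append_inj h (by simp)
      rw [ih (fun y hy => hl y (by simp [hy])) (fun y hy => hl' y (by simp [hy])) h2]
      congr 1
      refine Nat.eq_of_testBit_eq fun i => ?_
      rcases lt_or_ge i w with hi | hi
      · exact List.map_inj_left.1 h1 i (List.mem_range.2 hi)
      · have hp : 2 ^ w ≤ 2 ^ i := Nat.pow_le_pow_right (by norm_num) hi
        rw [Nat.testBit_lt_two_pow ((hl x (by simp)).trans_le hp),
          Nat.testBit_lt_two_pow ((hl' x' (by simp)).trans_le hp)]

theorem lt_two_pow_width {G : WrittenGrammar σ} {x : ℕ} (hx : x ∈ G.codes) : x < 2 ^ G.width := by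
  have h1 : ∀ l : List ℕ, x ∈ l → x ≤ l.foldr max 0 := by
    intro l
    induction l with
    | nil => simp
    | cons y l ih =>
      intro h
      rcases List.mem_cons.1 h with rfl | h
      · exact le_max_left _ _
      · exact (ih h).trans (le_max_right _ _)
  exact (h1 _ hx).trans_lt (Nat.lt_size_self _)

theorem width_pos (G : WrittenGrammar σ) : 0 < G.width := by
  by_contra h
  have h1 := lt_two_pow_width (G := G) (x := σ + 1 + G.start) (List.mem_cons_self ..)
  rw [Nat.eq_zero_of_not_pos h] at h1
  omega

theorem toBits_injective : Function.Injective (toBits (σ := σ)) := by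
  intro G G' h
  obtain ⟨h1, h2⟩ := replicate_true_append_inj h
  rw [← h1] at h2
  exact codes_injective (binary_flatMap_inj G.width_pos (fun _ => lt_two_pow_width)
    (fun _ hx => h1 ▸ lt_two_pow_width hx) h2)

end WrittenGrammar

/-! ### Kolmogorov complexity -/

theorem IsProgramFor.unique {σ : ℕ} {w : List Bool} {x x' : List (Fin σ)}
    (h : IsProgramFor w x) (h' : IsProgramFor w x') : x = x' := by
  obtain ⟨i, y, rfl, h⟩ := h
  obtain ⟨i', y', hw, h'⟩ := h'
  obtain ⟨rfl, rfl⟩ := replicate_true_append_inj hw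
  exact Encodable.encode_injective (Part.mem_unique h h')

/-- Distinct strings have distinct shortest programs. -/
theorem ncard_lt_of_kolmogorovComplexity_le {σ : ℕ} {S : Set (List (Fin σ))} {N : ℕ}
    (hS : ∀ x ∈ S, kolmogorovComplexity x ≤ N) : S.ncard < 2 ^ (N + 1) := by
  have h : ∀ x : List (Fin σ), ∃ w, IsProgramFor w x ∧ w.length = kolmogorovComplexity x := by
    intro x
    obtain ⟨w, hw⟩ := exists_isProgramFor x
    exact Nat.sInf_mem (s := {k | ∃ w : List Bool, IsProgramFor w x ∧ w.length = k})
      ⟨_, w, hw, rfl⟩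
  choose w hw hl using h
  refine lt_of_le_of_lt (Set.ncard_le_ncard_of_injOn (t := {l : List Bool | l.length ≤ N}) w
    (fun x hx => ?_) (fun x _ x' _ hxx => ?_) (finite_length_le Bool N)) (ncard_bits_length_le N)
  · exact (hl x).le.trans (hS x hx)
  · exact (hw x).unique (hxx ▸ hw x')

/-- At most half of the strings of a given length are compressible by more than two bits. -/
theorem two_mul_ncard_compressible_le {σ : ℕ} (hσ : 2 ≤ σ) (ℓ : ℕ) :
    2 * {t : List (Fin σ) | t.length = ℓ ∧
      (kolmogorovComplexity t : ℝ) < ℓ * Real.logb 2 σ - 2}.ncard ≤ σ ^ ℓ := by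
  set X := (ℓ : ℝ) * Real.logb 2 σ - 2 with hX
  rcases le_or_gt X 0 with h | h
  · have h1 : {t : List (Fin σ) | t.length = ℓ ∧ (kolmogorovComplexity t : ℝ) < X} = ∅ := by
      ext t
      simp only [Set.mem_ofPred_eq, Set.mem_empty_iff_false, iff_false, not_and, not_lt]
      exact fun _ => h.trans (Nat.cast_nonneg _)
    simp [h1]
  · have hpos : 0 < ⌈X⌉₊ := Nat.ceil_pos.2 h
    have h1 := ncard_lt_of_kolmogorovComplexity_le (N := ⌈X⌉₊ - 1)
      (S := {t : List (Fin σ) | t.length = ℓ ∧ (kolmogorovComplexity t : ℝ) < X})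
      fun t ht => Nat.le_sub_one_of_lt (Nat.lt_ceil.2 ht.2)
    rw [Nat.sub_add_cancel hpos] at h1
    -- The `- 2` in `X` pays for the ceiling and for the factor `2` in the claim.
    have h2 : (2 : ℝ) ^ (⌈X⌉₊ + 1) ≤ (σ : ℝ) ^ ℓ := by
      have h3 : (⌈X⌉₊ : ℝ) < X + 1 := Nat.ceil_lt_add_one h.le
      have h4 : (σ : ℝ) ^ ℓ = (2 : ℝ) ^ ((ℓ : ℝ) * Real.logb 2 σ) := by
        rw [mul_comm, Real.rpow_mul (by norm_num), Real.rpow_logb (by norm_num) (by norm_num)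
          (by positivity), Real.rpow_natCast]
      rw [h4, ← Real.rpow_natCast]
      refine Real.rpow_le_rpow_of_exponent_le (by norm_num) ?_
      push_cast
      linarith
    have h3 : 2 ^ (⌈X⌉₊ + 1) ≤ σ ^ ℓ := by exact_mod_cast h2
    rw [pow_succ] at h3
    omega

/-! ### Asymptotics -/

theorem tendsto_logb_natCast : Tendsto (fun n : ℕ => Real.logb 2 n) atTop atTop :=
  (Real.tendsto_logb_atTop (by norm_num)).comp tendsto_natCast_atTop_atTop

theorem eventually_logb_pow_lt (k : ℕ) {c : ℝ} (hc : 0 < c) :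
    ∀ᶠ n : ℕ in atTop, Real.logb 2 n ^ k < c * n := by
  have hlog : 0 < Real.log 2 ^ k := by positivity
  have h1 := ((Real.isLittleO_pow_log_id_atTop (n := k)).comp_tendsto
    tendsto_natCast_atTop_atTop).bound (half_pos (mul_pos hc hlog))
  filter_upwards [h1, eventually_gt_atTop 0] with n hn hpos
  have hpos' : (0 : ℝ) < n := by exact_mod_cast hpos
  simp only [Function.comp, id, Real.norm_eq_abs, abs_of_pos hpos'] at hn
  rw [Real.logb, div_pow, div_lt_iff₀ hlog]
  refine (le_abs_self _).trans_lt (hn.trans_lt ?_)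
  nlinarith [mul_pos (mul_pos hc hlog) hpos']

theorem eventually_ceil_le_logb_pow {f : ℕ → ℕ}
    (hf : ∃ k : ℕ, (fun n : ℕ => (f n : ℝ)) =O[atTop] fun n : ℕ => Real.logb 2 n ^ k) :
    ∃ k : ℕ, ∀ᶠ n : ℕ in atTop, (⌈(f n : ℝ) * Real.logb 2 n⌉₊ : ℝ) ≤ Real.logb 2 n ^ (k + 1) := by
  obtain ⟨k, hk⟩ := hf
  obtain ⟨A, hA⟩ := hk.bound
  -- One extra factor `log n` is the one in the product, the other absorbs the `O`-constant and the
  -- ceiling.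
  refine ⟨k + 1, ?_⟩
  filter_upwards [hA, tendsto_logb_natCast.eventually_ge_atTop (max (A + 1) 1)] with n hn hlog
  set X := Real.logb 2 n
  have h1 : 1 ≤ X := (le_max_right _ _).trans hlog
  have h2 : A + 1 ≤ X := (le_max_left _ _).trans hlog
  have h3 : 1 ≤ X ^ (k + 1) := one_le_pow₀ h1
  rw [Real.norm_of_nonneg (Nat.cast_nonneg _), Real.norm_of_nonneg (by positivity)] at hn
  refine (Nat.ceil_lt_add_one (by positivity)).le.trans ?_
  calc (f n : ℝ) * X + 1 ≤ A * X ^ k * X + X ^ (k + 1) := by gcongr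
    _ = (A + 1) * X ^ (k + 1) := by ring
    _ ≤ X * X ^ (k + 1) := by gcongr
    _ = X ^ (k + 1 + 1) := by ring

theorem size_le_logb_add_one {n : ℕ} (hn : 0 < n) : (n.size : ℝ) ≤ Real.logb 2 n + 1 := by
  have hs : 0 < n.size := Nat.size_pos.2 hn
  have h1 : 2 ^ (n.size - 1) ≤ n := Nat.lt_size.1 (Nat.sub_lt hs one_pos)
  have h2 : ((n.size - 1 : ℕ) : ℝ) ≤ Real.logb 2 n := by
    rw [Real.le_logb_iff_rpow_le (by norm_num) (by exact_mod_cast hn), Real.rpow_natCast]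
    exact_mod_cast h1
  rw [Nat.cast_sub hs] at h2
  push_cast at h2
  linarith

theorem smallestGrammarSize_periodicString_le_logb_pow {σ : ℕ} {ℓ : ℕ → ℕ} {k : ℕ}
    (hℓ : ∀ᶠ n in atTop, 0 < ℓ n)
    (hk : ∀ᶠ n : ℕ in atTop, (ℓ n : ℝ) ≤ Real.logb 2 n ^ (k + 1)) :
    ∀ᶠ n : ℕ in atTop, ∀ t : List (Fin σ), t.length = ℓ n →
      (smallestGrammarSize (periodicString t n) : ℝ) ≤ Real.logb 2 n ^ (k + 4) := by
  filter_upwards [hℓ, hk, eventually_gt_atTop 0,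
    tendsto_logb_natCast.eventually_ge_atTop (σ + 24)] with n hpos hn hn0 hlog t ht
  have h1 : (smallestGrammarSize (periodicString t n) : ℝ) ≤
      (σ + n.size + 4) * (2 * t.length + 5 * n.size + 12) := by
    exact_mod_cast WrittenGrammar.smallestGrammarSize_periodicString_le
      (List.length_pos_iff.1 (ht ▸ hpos)) n
  rw [ht] at h1
  have h2 := size_le_logb_add_one hn0
  set X := Real.logb 2 n
  have hσ : (0 : ℝ) ≤ σ := Nat.cast_nonneg _
  have hX : 24 ≤ X := by linarith
  have h3 : X ≤ X ^ (k + 1) := le_self_pow₀ (by linarith) (by omega)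
  have h4 : (σ + n.size + 4 : ℝ) ≤ X ^ 2 := by nlinarith
  -- With `n.size ≤ X + 1` the left side is at most `(2 + 5 + 17) * X ^ (k + 1)`, and `24 ≤ X`.
  have h5 : (2 * ℓ n + 5 * n.size + 12 : ℝ) ≤ X ^ (k + 2) := by
    have : X ^ (k + 2) = X * X ^ (k + 1) := by ring
    nlinarith
  calc _ ≤ _ := h1
    _ ≤ X ^ 2 * X ^ (k + 2) := by gcongr
    _ = X ^ (k + 4) := by ring

/-! ### Exceptional and incompressible strings, and the main theorem -/

/-- The exceptional strings of a lossless machine, as a function of `ε`. -/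
theorem OneStreamMachine.IsLossless.ncard_le_two_rpow {σ m p n ℓ : ℕ} {M : OneStreamMachine σ m}
    (hM : M.IsLossless p n) {ε : ℝ} (hε : 0 < ε) (hℓ : 0 < ℓ) (hℓn : ℓ ≤ n) (hm : 1 ≤ m)
    (hp : 1 ≤ p) (hmp : 36 * ((m * p : ℕ) : ℝ) ≤ ε * ℓ) :
    ({t : List (Fin σ) | t.length = ℓ ∧ ∃ w : List Bool,
      M.Outputs p (periodicString t n) w ∧ (w.length : ℝ) < ε / 16 * n}.ncard : ℝ) ≤
      (2 : ℝ) ^ (ε * ℓ) := by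
  set k := n / ℓ with hk
  -- The term `2 * L` uses half of the exponent `ε * ℓ`; the crossings get the other half. The
  -- factor `ε / 16` in the output bound fits since `n ≤ 2 * k * ℓ`.
  set L := ⌊ε / 4 * ℓ⌋₊ with hL
  have hk0 : 0 < k := Nat.div_pos hℓn hℓ
  have hkn : k * ℓ ≤ n := Nat.div_mul_le_self n ℓ
  have hn : n ≤ 2 * (k * ℓ) := by
    have := Nat.lt_mul_div_succ n hℓ
    rw [← hk] at this
    nlinarith
  have hn' : (n : ℝ) ≤ 2 * (k * ℓ) := by exact_mod_cast hn
  have hL1 : ε / 4 * ℓ < L + 1 := Nat.lt_floor_add_one _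
  have hL2 : (L : ℝ) ≤ ε / 4 * ℓ := Nat.floor_le (by positivity)
  have hsub : {t : List (Fin σ) | t.length = ℓ ∧ ∃ w : List Bool,
      M.Outputs p (periodicString t n) w ∧ (w.length : ℝ) < ε / 16 * n} ⊆
      {t : List (Fin σ) | t.length = ℓ ∧ ∃ w : List Bool, M.Outputs p (periodicString t n) w ∧
      2 * w.length ≤ (L + 1) * k} := by
    rintro t ⟨ht, w, hw, hwl⟩
    refine ⟨ht, w, hw, ?_⟩
    have hkr : (0 : ℝ) < k := by exact_mod_cast hk0
    have : (2 * w.length : ℝ) ≤ (L + 1) * k := by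
      calc (2 * w.length : ℝ) ≤ 2 * (ε / 16 * (2 * (k * ℓ))) := by
            have : ε / 16 * n ≤ ε / 16 * (2 * (k * ℓ)) := by gcongr
            linarith
        _ = (ε / 4 * ℓ) * k := by ring
        _ ≤ (L + 1) * k := by gcongr
    exact_mod_cast this
  have h1 := (Set.ncard_le_ncard hsub
    ((List.finite_length_eq (Fin σ) ℓ).subset fun t ht => ht.1)).trans
    (hM.ncard_le hℓ hk0 hkn L)
  have h2 : (2 * L + (m + 3) * (4 * p) + 2 : ℕ) ≤ ε * ℓ := by
    have h3 : (m + 3) * (4 * p) + 2 ≤ 18 * (m * p) := by nlinarith [Nat.mul_le_mul hm hp]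
    have h4 : (((m + 3) * (4 * p) + 2 : ℕ) : ℝ) ≤ 18 * ((m * p : ℕ) : ℝ) := by exact_mod_cast h3
    push_cast at h4 hmp ⊢
    linarith
  calc _ ≤ ((2 ^ (2 * L + (m + 3) * (4 * p) + 2) : ℕ) : ℝ) := by exact_mod_cast h1
    _ = (2 : ℝ) ^ ((2 * L + (m + 3) * (4 * p) + 2 : ℕ) : ℝ) := by
      rw [Real.rpow_natCast]
      push_cast
      rfl
    _ ≤ _ := Real.rpow_le_rpow_of_exponent_le (by norm_num) h2

/-- A machine that outputs grammars for its inputs is lossless. -/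
theorem OneStreamMachine.isLossless_of_grammars {σ m p n : ℕ} {M : OneStreamMachine σ m}
    (hM : ∀ s : List (Fin σ), s.length = n →
      ∃ G : WrittenGrammar σ, G.GeneratesOnly s ∧ M.Outputs p s G.toBits) :
    M.IsLossless p n := by
  refine ⟨fun s hs => (hM s hs).imp' _ fun G hG => hG.2, fun s s' w hs hs' hw hw' => ?_⟩
  have huniq : ∀ {s w w'}, M.Outputs p s w → M.Outputs p s w' → w' = w := by
    rintro s w w' h ⟨c, hr, hn, rfl, -⟩
    exact h.unique hr hn
  obtain ⟨G, hG, hGw⟩ := hM s hs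
  obtain ⟨G', hG', hGw'⟩ := hM s' hs'
  have h1 : G = G' :=
    WrittenGrammar.toBits_injective ((huniq hw hGw).trans (huniq hw' hGw').symm)
  subst h1
  exact Set.singleton_injective (hG.symm.trans hG')

theorem sq_le_two_pow {n : ℕ} (hn : 4 ≤ n) : n ^ 2 ≤ 2 ^ n := by
  induction n, hn using Nat.le_induction with
  | base => norm_num
  | succ n hn ih =>
    rw [pow_succ 2 n]
    nlinarith

/-- The exceptional sets of `ℓ` algorithms, for `ε = 1 / 4`, fill less than half of `2 ^ ℓ`: by `ℓ ≤
2 ^ (ℓ / 2)` the exponent is at most `1 + 3 * ℓ / 4`, which is below `ℓ` once `ℓ > 4`. -/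
theorem mul_two_rpow_lt {ℓ : ℕ} (hℓ : 5 ≤ ℓ) :
    2 * ((ℓ : ℝ) * (2 : ℝ) ^ (1 / 4 * (ℓ : ℝ))) < (2 : ℝ) ^ ℓ := by
  have h1 : (ℓ : ℝ) ≤ (2 : ℝ) ^ (1 / 2 * (ℓ : ℝ)) := by
    have h2 : (ℓ : ℝ) ^ 2 ≤ (2 : ℝ) ^ ℓ := by exact_mod_cast sq_le_two_pow (by omega : 4 ≤ ℓ)
    refine le_of_sq_le_sq ?_ (by positivity)
    rwa [← Real.rpow_mul_natCast (by norm_num), mul_comm (1 / 2 * (ℓ : ℝ)), ← mul_assoc,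
      show ((2 : ℕ) : ℝ) * (1 / 2) = 1 by norm_num, one_mul, Real.rpow_natCast]
  have h5 : (5 : ℝ) ≤ ℓ := by exact_mod_cast hℓ
  calc 2 * ((ℓ : ℝ) * (2 : ℝ) ^ (1 / 4 * (ℓ : ℝ)))
      ≤ (2 : ℝ) ^ (1 : ℝ) * ((2 : ℝ) ^ (1 / 2 * (ℓ : ℝ)) * (2 : ℝ) ^ (1 / 4 * (ℓ : ℝ))) := by
        rw [Real.rpow_one]
        gcongr
    _ = (2 : ℝ) ^ (1 + (1 / 2 * (ℓ : ℝ) + 1 / 4 * (ℓ : ℝ))) := by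
        rw [← Real.rpow_add (by norm_num), ← Real.rpow_add (by norm_num)]
    _ < (2 : ℝ) ^ (ℓ : ℝ) := Real.rpow_lt_rpow_of_exponent_lt (by norm_num) (by linarith)
    _ = (2 : ℝ) ^ ℓ := Real.rpow_natCast _ _

/-- There is an incompressible string outside a few small sets. -/
theorem exists_incompressible_notMem {σ ℓ k : ℕ} (hσ : 2 ≤ σ) (B : ℕ → Set (List (Fin σ)))
    (hB : 2 * ∑ i ∈ Finset.range k, (B i).ncard < σ ^ ℓ) (hfin : ∀ i < k, (B i).Finite) :
    ∃ t : List (Fin σ), t.length = ℓ ∧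
      (ℓ : ℝ) * Real.logb 2 σ - 2 ≤ kolmogorovComplexity t ∧ ∀ i < k, t ∉ B i := by
  -- Otherwise the compressible strings, at most half of all, and the sets `B i`, less than half,
  -- would cover everything.
  by_contra! hcon
  set S := {t : List (Fin σ) | t.length = ℓ ∧
      (kolmogorovComplexity t : ℝ) < ℓ * Real.logb 2 σ - 2} with hS
  have h1 : {t : List (Fin σ) | t.length = ℓ} ⊆ S ∪ ⋃ i ∈ Finset.range k, B i := by
    intro t ht
    by_cases hK : (kolmogorovComplexity t : ℝ) < ℓ * Real.logb 2 σ - 2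
    · exact Or.inl ⟨ht, hK⟩
    · obtain ⟨i, hi, hti⟩ := hcon t ht (not_lt.1 hK)
      exact Or.inr (Set.mem_biUnion (Finset.mem_coe.2 (Finset.mem_range.2 hi)) hti)
  have h2 : (S ∪ ⋃ i ∈ Finset.range k, B i).Finite := by
    refine ((List.finite_length_eq (Fin σ) ℓ).subset fun t ht => ht.1).union ?_
    exact (Finset.range k).finite_toSet.biUnion fun i hi => hfin i (by simpa using hi)
  have h3 := (Set.ncard_le_ncard h1 h2).trans (Set.ncard_union_le _ _)
  have h4 := Finset.set_ncard_biUnion_le (Finset.range k) B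
  have h5 := two_mul_ncard_compressible_le hσ ℓ
  rw [ncard_length_eq, Fintype.card_fin] at h3
  rw [← hS] at h5
  omega

/-- Strings over an alphabet of size `σ ≥ 2`; machines with one stream, `m n` bits of memory and
`p n` passes on inputs of length `n`, where `m p` is polylogarithmic; `ℓ n = ⌈m p log n⌉`. -/
theorem mainTheorem5 (σ : ℕ) (hσ : 2 ≤ σ) (m p ℓ : ℕ → ℕ)
    (hm : ∀ n, 1 ≤ m n) (hp : ∀ n, 1 ≤ p n)
    (hmp : ∃ k : ℕ, (fun n : ℕ => ((m n * p n : ℕ) : ℝ)) =O[atTop]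
      fun n : ℕ => Real.logb 2 n ^ k)
    (hℓ : ∀ n, ℓ n = ⌈((m n * p n : ℕ) : ℝ) * Real.logb 2 n⌉₊) :
    -- The smallest grammar cannot be approximated within any polynomial.
    (∀ C : ℕ, ∀ᶠ n in atTop, ∀ M : OneStreamMachine σ (m n),
      (∀ s : List (Fin σ), s.length = n →
        ∃ APPROX : WrittenGrammar σ, APPROX.GeneratesOnly s ∧ M.Outputs (p n) s APPROX.toBits) →
      ∃ (s : List (Fin σ)) (APPROX : WrittenGrammar σ), s.length = n ∧
        APPROX.GeneratesOnly s ∧ M.Outputs (p n) s APPROX.toBits ∧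
        smallestGrammarSize s ^ C < APPROX.toBits.length) ∧
    -- Strings with period `ℓ n` have grammars of polylogarithmic size.
    (∃ k : ℕ, ∀ᶠ n in atTop, ∀ t : List (Fin σ), t.length = ℓ n →
      (smallestGrammarSize (periodicString t n) : ℝ) ≤ Real.logb 2 n ^ k) ∧
    -- Each lossless one-stream machine outputs `Ω(n)` bits on those whose repeated substring is
    -- not compressible by more than a constant factor: all but `2 ^ (ε ℓ n)` of them.
    (∀ ε : ℝ, 0 < ε → ∃ c : ℝ, 0 < c ∧ ∀ᶠ n in atTop, ∀ M : OneStreamMachine σ (m n),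
      M.IsLossless (p n) n →
      ({t : List (Fin σ) | t.length = ℓ n ∧ ∃ w : List Bool,
        M.Outputs (p n) (periodicString t n) w ∧ (w.length : ℝ) < c * n}.ncard : ℝ) ≤
        (2 : ℝ) ^ (ε * ℓ n)) ∧
    -- For any countable collection of lossless one-stream algorithms, there are incompressible
    -- repeated substrings on which every algorithm of the collection outputs `Ω(n)` bits.
    (∀ A : ℕ → (n : ℕ) → OneStreamMachine σ (m n), (∀ i n, (A i n).IsLossless (p n) n) →
      ∃ t : ℕ → List (Fin σ),
        (∀ n, (t n).length = ℓ n ∧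
          (ℓ n : ℝ) * Real.logb 2 σ - 2 ≤ kolmogorovComplexity (t n)) ∧
        ∃ c : ℝ, 0 < c ∧ ∀ i, ∀ᶠ n in atTop, ∀ w : List Bool,
          (A i n).Outputs (p n) (periodicString (t n) n) w → c * n ≤ w.length) := by

  have hℓlog : ∀ n, ((m n * p n : ℕ) : ℝ) * Real.logb 2 n ≤ ℓ n := fun n => by
    rw [hℓ]
    exact Nat.le_ceil _
  have hℓlog' : ∀ᶠ n : ℕ in atTop, Real.logb 2 n ≤ ℓ n := by
    filter_upwards [tendsto_logb_natCast.eventually_ge_atTop 0] with n hn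
    have h1 : (1 : ℝ) ≤ ((m n * p n : ℕ) : ℝ) := by exact_mod_cast Nat.mul_le_mul (hm n) (hp n)
    nlinarith [hℓlog n]
  have hℓtop : Tendsto ℓ atTop atTop :=
    tendsto_natCast_atTop_iff.1 (tendsto_atTop_mono' _ hℓlog' tendsto_logb_natCast)
  have hℓpos : ∀ᶠ n in atTop, 0 < ℓ n := hℓtop.eventually_gt_atTop 0
  obtain ⟨k, hk⟩ := eventually_ceil_le_logb_pow hmp
  simp only [← hℓ] at hk
  have hℓn : ∀ᶠ n in atTop, ℓ n ≤ n := by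
    filter_upwards [hk, eventually_logb_pow_lt (k + 1) one_pos] with n h1 h2
    have : (ℓ n : ℝ) ≤ n := by linarith
    exact_mod_cast this
  have hgrammar := smallestGrammarSize_periodicString_le_logb_pow (σ := σ) hℓpos hk
  have hlossless : ∀ ε : ℝ, 0 < ε → ∃ c : ℝ, 0 < c ∧ ∀ᶠ n in atTop,
      ∀ M : OneStreamMachine σ (m n), M.IsLossless (p n) n →
      ({t : List (Fin σ) | t.length = ℓ n ∧ ∃ w : List Bool,
        M.Outputs (p n) (periodicString t n) w ∧ (w.length : ℝ) < c * n}.ncard : ℝ) ≤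
        (2 : ℝ) ^ (ε * ℓ n) := by
    intro ε hε
    refine ⟨ε / 16, by positivity, ?_⟩
    -- The factor `log n` in `ℓ` makes `36 * m * p ≤ ε * ℓ` for large `n`, for any fixed `ε`.
    filter_upwards [hℓpos, hℓn, tendsto_logb_natCast.eventually_ge_atTop (36 / ε)]
      with n h1 h2 h3 M hM
    refine hM.ncard_le_two_rpow hε h1 h2 (hm n) (hp n) ?_
    have h4 : 36 ≤ ε * Real.logb 2 n := by
      rwa [div_le_iff₀ hε, mul_comm] at h3
    calc 36 * ((m n * p n : ℕ) : ℝ) ≤ ε * Real.logb 2 n * ((m n * p n : ℕ) : ℝ) := by gcongr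
      _ = ε * (((m n * p n : ℕ) : ℝ) * Real.logb 2 n) := by ring
      _ ≤ ε * ℓ n := by gcongr; exact hℓlog n
  refine ⟨fun C => ?_, ⟨k + 4, hgrammar⟩, hlossless, fun A hA => ?_⟩
  -- Any `ε < 1` would do: the exceptional set must be smaller than `σ ^ ℓ n ≥ 2 ^ ℓ n`.
  · obtain ⟨c, hc, hcn⟩ := hlossless (1 / 2) (by norm_num)
    filter_upwards [hcn, hℓpos, hgrammar, eventually_logb_pow_lt ((k + 4) * C) hc]
      with n h1 h2 h3 h4 M hM
    have h5 := h1 M (OneStreamMachine.isLossless_of_grammars hM)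
    obtain ⟨t, ht, hw⟩ : ∃ t : List (Fin σ), t.length = ℓ n ∧ ∀ w : List Bool,
        M.Outputs (p n) (periodicString t n) w → c * n ≤ w.length := by
      by_contra! hcon
      have h6 : {t : List (Fin σ) | t.length = ℓ n ∧ ∃ w : List Bool,
          M.Outputs (p n) (periodicString t n) w ∧ (w.length : ℝ) < c * n} =
          {t : List (Fin σ) | t.length = ℓ n} :=
        Set.ext fun t => ⟨fun h => h.1, fun h => ⟨h, hcon t h⟩⟩
      rw [h6, ncard_length_eq, Fintype.card_fin] at h5
      have h7 : (2 : ℝ) ^ (ℓ n : ℝ) ≤ ((σ ^ ℓ n : ℕ) : ℝ) := by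
        rw [Real.rpow_natCast]
        exact_mod_cast Nat.pow_le_pow_left hσ _
      have h8 : (2 : ℝ) ^ (1 / 2 * (ℓ n : ℝ)) < (2 : ℝ) ^ (ℓ n : ℝ) := by
        refine Real.rpow_lt_rpow_of_exponent_lt (by norm_num) ?_
        have : (0 : ℝ) < ℓ n := by exact_mod_cast h2
        linarith
      linarith
    have hlen := length_periodicString (t := t) (by rintro rfl; simp at ht; omega) n
    obtain ⟨G, hG, hGw⟩ := hM _ hlen
    refine ⟨_, G, hlen, hG, hGw, ?_⟩
    have h6 : ((smallestGrammarSize (periodicString t n) ^ C : ℕ) : ℝ) < G.toBits.length := by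
      push_cast
      calc _ ≤ (Real.logb 2 n ^ (k + 4)) ^ C := by gcongr; exact h3 t ht
        _ = Real.logb 2 n ^ ((k + 4) * C) := (pow_mul _ _ _).symm
        _ < c * n := h4
        _ ≤ _ := hw _ hGw
    exact_mod_cast h6
  · obtain ⟨c, hc, hcn⟩ := hlossless (1 / 4) (by norm_num)
    -- Incompressibility is required for every `n`, the lower bounds only where the counting bound
    -- holds. At `n` only the algorithms with index below `ℓ n` are handled; as `ℓ` tends to
    -- infinity, each is handled eventually, with the same `c`.
    have hex : ∀ n, ∃ t : List (Fin σ), (t.length = ℓ n ∧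
        (ℓ n : ℝ) * Real.logb 2 σ - 2 ≤ kolmogorovComplexity t) ∧
        (5 ≤ ℓ n → (∀ M : OneStreamMachine σ (m n), M.IsLossless (p n) n →
          ({t : List (Fin σ) | t.length = ℓ n ∧ ∃ w : List Bool,
            M.Outputs (p n) (periodicString t n) w ∧ (w.length : ℝ) < c * n}.ncard : ℝ) ≤
            (2 : ℝ) ^ (1 / 4 * (ℓ n : ℝ))) →
          ∀ i < ℓ n, ∀ w : List Bool,
            (A i n).Outputs (p n) (periodicString t n) w → c * n ≤ w.length) := by
      intro n
      by_cases hgood : 5 ≤ ℓ n ∧ ∀ M : OneStreamMachine σ (m n), M.IsLossless (p n) n →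
          ({t : List (Fin σ) | t.length = ℓ n ∧ ∃ w : List Bool,
            M.Outputs (p n) (periodicString t n) w ∧ (w.length : ℝ) < c * n}.ncard : ℝ) ≤
            (2 : ℝ) ^ (1 / 4 * (ℓ n : ℝ))
      · obtain ⟨t, h1, h2, h3⟩ := exists_incompressible_notMem (ℓ := ℓ n) (k := ℓ n) hσ
          (fun i => {t : List (Fin σ) | t.length = ℓ n ∧ ∃ w : List Bool,
            (A i n).Outputs (p n) (periodicString t n) w ∧ (w.length : ℝ) < c * n})
          (by
            have h4 := mul_two_rpow_lt hgood.1
            have h5 : (2 : ℝ) ^ ℓ n ≤ (σ : ℝ) ^ ℓ n := by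
              gcongr
              exact_mod_cast hσ
            have h6 := Finset.sum_le_sum fun i (_ : i ∈ Finset.range (ℓ n)) =>
              hgood.2 (A i n) (hA i n)
            rw [Finset.sum_const, Finset.card_range, nsmul_eq_mul] at h6
            have h7 := ((mul_le_mul_of_nonneg_left h6 zero_le_two).trans_lt h4).trans_le h5
            exact_mod_cast h7)
          (fun i _ => (List.finite_length_eq (Fin σ) (ℓ n)).subset fun t ht => ht.1)
        refine ⟨t, ⟨h1, h2⟩, fun _ _ i hi w hw => ?_⟩
        by_contra hlt
        exact h3 i hi ⟨h1, w, hw, not_le.1 hlt⟩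
      -- For the remaining `n` no set has to be avoided.
      · obtain ⟨t, h1, h2, -⟩ := exists_incompressible_notMem (ℓ := ℓ n) (k := 0) hσ
          (fun _ => ∅) (by simpa using Nat.pow_pos (by omega)) (by simp)
        exact ⟨t, ⟨h1, h2⟩, fun h h' => absurd ⟨h, h'⟩ hgood⟩
    choose t ht ht' using hex
    refine ⟨t, ht, c, hc, fun i => ?_⟩
    filter_upwards [hcn, hℓtop.eventually_ge_atTop 5, hℓtop.eventually_gt_atTop i]
      with n h1 h2 h3
    exact ht' n h2 h1 i h3
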